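/- **Theorem (Contraction property).** Let $(X,d)$ be a complete metric space, $\lambda\in\mathbb{R}$, and let $\phi:X\to(-\infty,\infty]$ be lower semi-continuous with $D(\phi):=\{x:\phi(x)<\infty\}\neq\emptyset$. A minimal geodesic from $x$ to $y$ is a curve $\gamma:[0,1]\to X$ with $\gamma(0)=x$, $\gamma(1)=y$ and $d(\gamma(s),\gamma(t))=|s-t|\,d(x,y)$ for all $s,t\in[0,1]$. For a family $\Gamma$ of minimal geodesics, $\phi$ is called $\lambda$-convex along $\Gamma$ if any $x,y\in D(\phi)$ are joined by some $\gamma\in\Gamma$ from $x$ to $y$ with $$\phi(\gamma(t))\le(1-t)\phi(x)+t\phi(y)-\tfrac{\lambda}{2}(1-t)t\,d^2(x,y)\qquad(0\le t\le1).$$ For $\tau>0$ and $x\in X$ put $\phi_\tau(x):=\inf_{z\in X}\{\phi(z)+d^2(x,z)/(2\tau)\}$ and $J_\tau(x):=\{z\in X:\phi(z)+d^2(x,z)/(2\tau)=\phi_\tau(x)\}$. Assume one of the following. * **Case I.** $(X,d)$ is a $\mathrm{CAT}(1)$-space (of arbitrary diameter): any two points are joined by a minimal geodesic, and for all $x,y,z\in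 X$ with $d(x,y)+d(y,z)+d(z,x)<2\pi$ and every minimal geodesic $\gamma$ from $y$ to $z$ one has $d(x,\gamma(t))\le d_{\mathbb{S}^2}(\tilde x,\tilde\gamma(t))$ for $t\in[0,1]$, where $\triangle\tilde x\tilde y\tilde z$ is a triangle in the unit sphere $\mathbb{S}^2$ with the same side lengths as $\triangle xyz$ and $\tilde\gamma$ is the minimal geodesic from $\tilde y$ to $\tilde z$. Moreover $\phi$ is $\lambda$-convex along the family of all minimal geodesics. * **Case II.** There are a family $\Gamma$ of minimal geodesics and $K\in\mathbb{R}$ (possibly negative) such that: 1. $\phi$ is $\lambda$-convex along $\Gamma$; 2. for every $z\in X$ and every $\gamma\in\Gamma$ from $x$ to $y$, $d^2(\gamma(t),z)\le(1-t)d^2(x,z)+t\,d^2(y,z)-\frac K2(1-t)t\,d^2(x,y)$ for $t\in[0,1]$; 3. for all $\gamma,\eta\in\Gamma$ from $x$ to $y$ and from $x$ to $z$, respectively, the following limits exist and are equal: $$\lim_{s\downarrow0}\frac{d^2(\gamma(s),z)-d^2(x,z)}{s}=\lim_{t\downarrow0}\frac{d^2(\eta(t),y)-d^2(x,y)}{t};$$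 4. there is $\tau_*>0$ such that $\phi_\tau(x)>-\infty$ and $J_\tau(x)\ne\emptyset$ for all $x\in X$ and $\tau\in(0,\tau_*)$. A gradient curve of $\phi$ starting from $x_0\in D(\phi)$ is a curve $\xi:[0,\infty)\to X$ for which there are partitions $0=t_i^0<t_i^1<\cdots$, $\lim_{k\to\infty}t_i^k=\infty$ $(i\in\mathbb{N})$, with $\sup_{k\ge1}(t_i^k-t_i^{k-1})\to0$ as $i\to\infty$, and discrete solutions $x_i^0=x_0$, $x_i^k\in J_{t_i^k-t_i^{k-1}}(x_i^{k-1})$ $(k\ge1)$, such that the interpolations $\bar x_i(0):=x_0$, $\bar x_i(t):=x_i^k$ for $t\in(t_i^{k-1},t_i^k]$, converge to $\xi$ pointwise on $[0,\infty)$. Then for every $x_0\in D(\phi)$ there is exactly one gradient curve $\mathcal{G}(\cdot,x_0)$ of $\phi$ starting from $x_0$. Moreover, for all $x_0,y_0\in D(\phi)$, the curves $\xi:=\mathcal{G}(\cdot,x_0)$ and $\zeta:=\mathcal{G}(\cdot,y_0)$ satisfy $$d(\xi(t),\zeta(t))\le e^{-\lambda t}\,d(x_0,y_0)\qquad\text{for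 all }t>0.$$ -/

import Mathlib

open Filter Topology
open scoped NNReal ENNReal

noncomputable section

namespace MetricFlow

/-! ### Geodesics and `CAT(1)`-spaces -/

/-- `γ`, restricted to `[0,1]`, is a minimal geodesic from `x` to `y`
(values of `γ` outside `[0,1]` play no role). -/
def IsMinGeodesic {X : Type*} [MetricSpace X] (γ : ℝ → X) (x y : X) : Prop :=
  γ 0 = x ∧ γ 1 = y ∧
    ∀ s ∈ Set.Icc (0 : ℝ) 1, ∀ t ∈ Set.Icc (0 : ℝ) 1, dist (γ s) (γ t) = |s - t| * dist x y

/-- The ambient space of the unit sphere `S²`. -/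
abbrev E3 : Type := EuclideanSpace ℝ (Fin 3)

/-- The (angular) Riemannian distance of the unit sphere `S² ⊆ ℝ³`. -/
def sphereDist (a b : E3) : ℝ := InnerProductGeometry.angle a b

/-- `σ`, restricted to `[0,1]`, is a minimal geodesic of the unit sphere `S²` from `b` to `c`. -/
def IsSphereGeodesic (σ : ℝ → E3) (b c : E3) : Prop :=
  σ 0 = b ∧ σ 1 = c ∧ (∀ t ∈ Set.Icc (0 : ℝ) 1, σ t ∈ Metric.sphere (0 : E3) 1) ∧
    ∀ s ∈ Set.Icc (0 : ℝ) 1, ∀ t ∈ Set.Icc (0 : ℝ) 1,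
      sphereDist (σ s) (σ t) = |s - t| * sphereDist b c

/-- `a, b, c` are the vertices of a comparison triangle in `S²` of the triangle `x, y, z`. -/
def IsComparisonTriangle {X : Type*} [MetricSpace X] (x y z : X) (a b c : E3) : Prop :=
  a ∈ Metric.sphere (0 : E3) 1 ∧ b ∈ Metric.sphere (0 : E3) 1 ∧ c ∈ Metric.sphere (0 : E3) 1 ∧
    sphereDist a b = dist x y ∧ sphereDist b c = dist y z ∧ sphereDist c a = dist z x

/-- `CAT(1)`-spaces. The comparison triangle is unique up to rigid motions, and the minimal
geodesic between two of its vertices (which have distance `< π`) is unique. -/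
def IsCAT1 (X : Type*) [MetricSpace X] : Prop :=
  (∀ x y : X, ∃ γ : ℝ → X, IsMinGeodesic γ x y) ∧
    ∀ x y z : X, dist x y + dist y z + dist z x < 2 * Real.pi →
      ∀ γ : ℝ → X, IsMinGeodesic γ y z →
        ∃ (a b c : E3) (σ : ℝ → E3), IsComparisonTriangle x y z a b c ∧ IsSphereGeodesic σ b c ∧
          ∀ t ∈ Set.Icc (0 : ℝ) 1, dist x (γ t) ≤ sphereDist a (σ t)

/-! ### Semi-convexity, commutativity, coercivity -/

/-- The effective domain `D(φ)` of a function `φ : X → (-∞,∞]`. -/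
def dom {X : Type*} (φ : X → EReal) : Set X := {x | φ x ≠ ⊤}

/-- `λ`-convexity with respect to a family `Γ` of curves: any two points of `D(φ)` are joined by a
minimal geodesic in `Γ` along which the `λ`-convexity inequality holds. -/
def IsLambdaConvex {X : Type*} [MetricSpace X] (Γ : Set (ℝ → X)) (lam : ℝ) (φ : X → EReal) :
    Prop :=
  ∀ x ∈ dom φ, ∀ y ∈ dom φ, ∃ γ ∈ Γ, IsMinGeodesic γ x y ∧
    ∀ t ∈ Set.Icc (0 : ℝ) 1,
      φ (γ t) ≤ (((1 - t) * (φ x).toReal + t * (φ y).toReal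
        - lam / 2 * (1 - t) * t * dist x y ^ 2 : ℝ) : EReal)

/-- `K`-convexity of every squared distance function `d²(·, z)` along the geodesics of `Γ`. -/
def SqDistConvex {X : Type*} [MetricSpace X] (Γ : Set (ℝ → X)) (K : ℝ) : Prop :=
  ∀ γ ∈ Γ, ∀ x y : X, IsMinGeodesic γ x y → ∀ z : X, ∀ t ∈ Set.Icc (0 : ℝ) 1,
    dist (γ t) z ^ 2 ≤ (1 - t) * dist x z ^ 2 + t * dist y z ^ 2
      - K / 2 * (1 - t) * t * dist x y ^ 2

/-- Commutativity along `Γ`: for `γ, η ∈ Γ` from `x` to `y` and from `x` to `z`, respectively, the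
one-sided derivatives at `0` of `d²(γ(·), z)` and of `d²(η(·), y)` exist and coincide. -/
def SqDistCommutes {X : Type*} [MetricSpace X] (Γ : Set (ℝ → X)) : Prop :=
  ∀ γ ∈ Γ, ∀ η ∈ Γ, ∀ x y z : X, IsMinGeodesic γ x y → IsMinGeodesic η x z →
    ∃ l : ℝ,
      Tendsto (fun s : ℝ => (dist (γ s) z ^ 2 - dist x z ^ 2) / s) (𝓝[>] 0) (𝓝 l) ∧
      Tendsto (fun t : ℝ => (dist (η t) y ^ 2 - dist x y ^ 2) / t) (𝓝[>] 0) (𝓝 l)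

/-- The Moreau--Yosida approximation `φ_τ(x) = inf_z {φ(z) + d²(x,z)/(2τ)}`. -/
def moreauYosida {X : Type*} [MetricSpace X] (φ : X → EReal) (τ : ℝ) (x : X) : EReal :=
  ⨅ z : X, φ z + ((dist x z ^ 2 / (2 * τ) : ℝ) : EReal)

/-- The set `J_τ(x)` of minimizers in the Moreau--Yosida approximation. -/
def minimizers {X : Type*} [MetricSpace X] (φ : X → EReal) (τ : ℝ) (x : X) : Set X :=
  {z | φ z + ((dist x z ^ 2 / (2 * τ) : ℝ) : EReal) = moreauYosida φ τ x}

/-- Coercivity: `φ_τ(x) > -∞` and `J_τ(x) ≠ ∅` for all `x` and all sufficiently small `τ > 0`,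
uniformly in `x`. -/
def IsCoercive {X : Type*} [MetricSpace X] (φ : X → EReal) : Prop :=
  ∃ τs : ℝ, 0 < τs ∧ ∀ x : X, ∀ τ : ℝ, 0 < τ → τ < τs →
    ⊥ < moreauYosida φ τ x ∧ (minimizers φ τ x).Nonempty

/-! ### Discrete solutions and gradient curves -/

/-- A partition `0 = t⁰ < t¹ < ⋯`, `tᵏ → ∞`, of `[0,∞)`. -/
structure TimePartition where
  pt : ℕ → ℝ
  pt_zero : pt 0 = 0
  pt_strictMono : StrictMono pt
  pt_tendsto : Tendsto pt atTop atTop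

/-- The mesh `sup_k (tᵏ - tᵏ⁻¹)` (possibly infinite). -/
def TimePartition.mesh (P : TimePartition) : ℝ≥0∞ :=
  ⨆ k : ℕ, ENNReal.ofReal (P.pt (k + 1) - P.pt k)

/-- Discrete solutions of the variational scheme for `φ` with initial point `x₀`. -/
def IsDiscreteSolution {X : Type*} [MetricSpace X] (φ : X → EReal) (P : TimePartition)
    (x₀ : X) (x : ℕ → X) : Prop :=
  x 0 = x₀ ∧ ∀ k : ℕ, x (k + 1) ∈ minimizers φ (P.pt (k + 1) - P.pt k) (x k)

/-- The piecewise constant interpolation: `x⁰` at time `0` and `xᵏ` on `(tᵏ⁻¹, tᵏ]`; the index of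
time `t` is the least `k` with `t ≤ tᵏ`. -/
def TimePartition.interp {X : Type*} (P : TimePartition) (x : ℕ → X) (t : ℝ≥0) : X :=
  x (sInf {k : ℕ | (t : ℝ) ≤ P.pt k})

/-- `ξ : [0,∞) → X` is a gradient curve of `φ` starting from `x₀`: a pointwise limit of
interpolated discrete solutions starting from `x₀` whose partitions have mesh tending to `0`. -/
def IsGradientCurve {X : Type*} [MetricSpace X] (φ : X → EReal) (x₀ : X) (ξ : ℝ≥0 → X) : Prop :=
  ∃ (P : ℕ → TimePartition) (x : ℕ → ℕ → X),
    Tendsto (fun i => (P i).mesh) atTop (𝓝 0) ∧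
    (∀ i, IsDiscreteSolution φ (P i) x₀ (x i)) ∧
    ∀ t : ℝ≥0, Tendsto (fun i => (P i).interp (x i) t) atTop (𝓝 (ξ t))

end MetricFlow

end

/-!
The argument is metric throughout. The implicit Euler step satisfies a discrete evolution
variational inequality (EVI): if `z` minimizes `f + d²(x, ·) / (2τ)`, then testing minimality along
the convex geodesic from `z` to a nearby point `y` and differentiating at `z` bounds
`(1 + λτ) d²(z, y) - d²(x, y)` by `2τ (f y - f z)` and a multiple of `d²(x, z)`. The derivative of
the squared distance is controlled by commutativity and `K`-convexity in Case II, and by the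
spherical law of cosines in Case I; only small triangles matter.

Comparing two discrete solutions step by step through the EVI is a doubling of variables in the
style of Crandall--Liggett and Kobayashi: the squared distance of the two solutions is dominated by
an explicit function of the two times, with an error that vanishes with the meshes. A change of time
reduces `λ` to `0`. This yields Cauchy estimates for discrete solutions from one initial point and
the contraction for nearby initial points, which is then globalized by subdividing a geodesic.
-/

namespace MetricFlow

section Scheme

variable {X : Type*} [MetricSpace X] {S : Set X} {f : X → ℝ}

/-- The resolvent relation `z ∈ J_τ(x)` for a real-valued function `f` on a set `S`. A function
`φ : X → (-∞,∞]` is studied through its real part on `S = D(φ)`. -/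
def IsProx (S : Set X) (f : X → ℝ) (τ : ℝ) (x z : X) : Prop :=
  z ∈ S ∧ ∀ w ∈ S, f z + dist x z ^ 2 / (2 * τ) ≤ f w + dist x w ^ 2 / (2 * τ)

/-- A discrete solution for `f` on `S` along the partition `P`, with all steps at most `ε`. -/
structure IsScheme (S : Set X) (f : X → ℝ) (ε : ℝ) (P : TimePartition) (x : ℕ → X) : Prop where
  mem_zero : x 0 ∈ S
  step_le : ∀ k, P.pt (k + 1) - P.pt k ≤ ε
  prox : ∀ k, IsProx S f (P.pt (k + 1) - P.pt k) (x k) (x (k + 1))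

/-- Quadratic decay of `f` seen from `x`; it makes `f + d²(x, ·) / (2τ)` bounded below for small
`τ`. -/
def QuadraticLowerBound (S : Set X) (f : X → ℝ) (C : ℝ) (x : X) : Prop :=
  ∀ w ∈ S, f x - f w ≤ C * (1 + dist x w ^ 2)

lemma TimePartition.pt_nonneg (P : TimePartition) (k : ℕ) : 0 ≤ P.pt k :=
  P.pt_zero ▸ P.pt_strictMono.monotone k.zero_le

lemma TimePartition.step_pos (P : TimePartition) (k : ℕ) : 0 < P.pt (k + 1) - P.pt k :=
  sub_pos.2 (P.pt_strictMono k.lt_succ_self)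

lemma sq_add_le_of_sq_le {p q a b u v : ℝ} (ha : 0 ≤ a) (hb : 0 ≤ b) (hu : 0 ≤ u) (hv : 0 ≤ v)
    (hp : p ^ 2 ≤ a * u) (hq : q ^ 2 ≤ b * v) : (p + q) ^ 2 ≤ (a + b) * (u + v) := by
  have hpq : (p * q) ^ 2 ≤ ((a * v + b * u) / 2) ^ 2 :=
    calc (p * q) ^ 2 = p ^ 2 * q ^ 2 := mul_pow p q 2
      _ ≤ (a * u) * (b * v) := by gcongr
      _ ≤ ((a * v + b * u) / 2) ^ 2 := by linarith [sq_nonneg (a * v - b * u)]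
  linarith [le_of_sq_le_sq hpq (by positivity)]

lemma sq_add_le_one_add_mul {p q θ : ℝ} (hθ : 0 < θ) :
    (p + q) ^ 2 ≤ (1 + θ) * p ^ 2 + (1 + 1 / θ) * q ^ 2 := by
  have h : 0 ≤ (θ * p - q) ^ 2 / θ := by positivity
  have e : (θ * p - q) ^ 2 / θ = θ * p ^ 2 - 2 * (p * q) + 1 / θ * q ^ 2 := by
    field_simp
    ring
  linarith

lemma IsProx.sq_dist_le {τ : ℝ} (hτ : 0 < τ) {x z : X} (hx : x ∈ S) (h : IsProx S f τ x z) :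
    dist x z ^ 2 ≤ 2 * τ * (f x - f z) := by
  have hxx := h.2 x hx
  rw [dist_self, zero_pow two_ne_zero, zero_div, add_zero, ← le_sub_iff_add_le',
    div_le_iff₀ (by positivity)] at hxx
  linarith

lemma IsProx.le {τ : ℝ} (hτ : 0 < τ) {x z : X} (hx : x ∈ S) (h : IsProx S f τ x z) :
    f z ≤ f x := by
  have := nonneg_of_mul_nonneg_right ((sq_nonneg _).trans (h.sq_dist_le hτ hx)) (by positivity)
  linarith

namespace IsScheme

variable {ε : ℝ} {P : TimePartition} {x : ℕ → X}

lemma mem (h : IsScheme S f ε P x) : ∀ k, x k ∈ S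
  | 0 => h.mem_zero
  | k + 1 => (h.prox k).1

lemma succ_le (h : IsScheme S f ε P x) (k : ℕ) : f (x (k + 1)) ≤ f (x k) :=
  (h.prox k).le (P.step_pos k) (h.mem k)

lemma le_of_le (h : IsScheme S f ε P x) {j k : ℕ} (hjk : j ≤ k) : f (x k) ≤ f (x j) :=
  antitone_nat_of_succ_le (f := fun k => f (x k)) h.succ_le hjk

lemma sq_dist_le (h : IsScheme S f ε P x) {j k : ℕ} (hjk : j ≤ k) :
    dist (x j) (x k) ^ 2 ≤ 2 * (P.pt k - P.pt j) * (f (x j) - f (x k)) := by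
  induction k, hjk using Nat.le_induction with
  | base => simp
  | succ k hjk ih =>
    have hτ := P.step_pos k
    have ht := P.pt_strictMono.monotone hjk
    have hf := h.le_of_le hjk
    have hf' := h.succ_le k
    have hstep := (h.prox k).sq_dist_le hτ (h.mem k)
    calc dist (x j) (x (k + 1)) ^ 2
        ≤ (dist (x j) (x k) + dist (x k) (x (k + 1))) ^ 2 := by gcongr; exact dist_triangle _ _ _
      _ ≤ (2 * (P.pt k - P.pt j) + 2 * (P.pt (k + 1) - P.pt k)) *
            (f (x j) - f (x k) + (f (x k) - f (x (k + 1)))) :=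
          sq_add_le_of_sq_le (by linarith) (by linarith) (sub_nonneg.2 hf) (sub_nonneg.2 hf') ih
            hstep
      _ = _ := by ring

lemma dist_le_sqrt (h : IsScheme S f ε P x) {n : ℕ} {M : ℝ} (hM : f (x 0) - f (x n) ≤ M)
    {j k : ℕ} (hjk : j ≤ k) (hk : k ≤ n) {s : ℝ} (hs : P.pt k - P.pt j ≤ s) :
    dist (x j) (x k) ≤ √(2 * s * M) := by
  have ht := P.pt_strictMono.monotone hjk
  have hf := h.le_of_le hjk
  refine Real.le_sqrt_of_sq_le ((h.sq_dist_le hjk).trans ?_)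
  exact mul_le_mul (by linarith) (by linarith [h.le_of_le j.zero_le, h.le_of_le hk])
    (sub_nonneg.2 hf) (by linarith)

end IsScheme

section Energy

variable {C : ℝ} {x₀ : X}

/-- The squared distance from `x₀` corrected by the drop of `f`. The weight of the drop absorbs the
squared step lengths of a discrete solution, so that this energy grows at most exponentially. -/
noncomputable def growthEnergy (f : X → ℝ) (C : ℝ) (x₀ x : X) : ℝ :=
  dist x₀ x ^ 2 - (f x₀ - f x) / (2 * C) + 1 / 2

lemma QuadraticLowerBound.sq_dist_le_growthEnergy (h : QuadraticLowerBound S f C x₀) (hC : 0 < C)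
    {x : X} (hx : x ∈ S) : dist x₀ x ^ 2 ≤ 2 * growthEnergy f C x₀ x := by
  have hdrop : (f x₀ - f x) / (2 * C) ≤ (1 + dist x₀ x ^ 2) / 2 := by
    rw [div_le_iff₀ (by positivity)]
    linarith [h x hx]
  rw [growthEnergy]
  linarith

lemma IsProx.growthEnergy_le {τ : ℝ} {x z : X} (h : IsProx S f τ x z)
    (h₀ : QuadraticLowerBound S f C x₀) (hC : 0 < C) (hx : x ∈ S) (hτ : 0 < τ)
    (hτC : 8 * C * τ ≤ 1) :
    growthEnergy f C x₀ z ≤ Real.exp (16 * C * τ) * growthEnergy f C x₀ x := by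
  have hCτ : 0 < 8 * C * τ := by positivity
  have hstep : (1 + 1 / (8 * C * τ)) * dist x z ^ 2 ≤ (f x - f z) / (2 * C) := by
    have hweight : 1 + 1 / (8 * C * τ) ≤ 2 / (8 * C * τ) := by
      rw [le_div_iff₀ hCτ, add_mul, one_div_mul_cancel hCτ.ne']
      linarith
    calc (1 + 1 / (8 * C * τ)) * dist x z ^ 2
        ≤ 2 / (8 * C * τ) * (2 * τ * (f x - f z)) := by gcongr; exact h.sq_dist_le hτ hx
      _ = (f x - f z) / (2 * C) := by field_simp; ring
  have hdist : dist x₀ z ^ 2 ≤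
      (1 + 8 * C * τ) * dist x₀ x ^ 2 + (1 + 1 / (8 * C * τ)) * dist x z ^ 2 :=
    (pow_le_pow_left₀ dist_nonneg (dist_triangle x₀ x z) 2).trans (sq_add_le_one_add_mul hCτ)
  have hbound := h₀.sq_dist_le_growthEnergy hC hx
  have hnonneg : 0 ≤ growthEnergy f C x₀ x := by linarith [sq_nonneg (dist x₀ x)]
  calc growthEnergy f C x₀ z ≤ growthEnergy f C x₀ x + 8 * C * τ * dist x₀ x ^ 2 := by
        simp only [growthEnergy, sub_div] at hstep ⊢
        linarith
    _ ≤ (16 * C * τ + 1) * growthEnergy f C x₀ x := by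
        linarith [mul_le_mul_of_nonneg_left hbound hCτ.le]
    _ ≤ Real.exp (16 * C * τ) * growthEnergy f C x₀ x := by
        gcongr
        exact Real.add_one_le_exp _

lemma growthEnergy_le_exp (h₀ : QuadraticLowerBound S f C x₀) (hC : 0 < C) {P : TimePartition}
    {x : ℕ → X} (hx₀ : x 0 = x₀) {n : ℕ} (hmem : ∀ k < n, x k ∈ S)
    (hstep : ∀ k < n, 8 * C * (P.pt (k + 1) - P.pt k) ≤ 1)
    (hprox : ∀ k < n, IsProx S f (P.pt (k + 1) - P.pt k) (x k) (x (k + 1))) :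
    2 * growthEnergy f C x₀ (x n) ≤ Real.exp (16 * C * P.pt n) := by
  induction n with
  | zero => simp [growthEnergy, hx₀, P.pt_zero]
  | succ n ih =>
    have hn := ih (fun k hk => hmem k (hk.trans n.lt_succ_self))
      (fun k hk => hstep k (hk.trans n.lt_succ_self)) fun k hk => hprox k (hk.trans n.lt_succ_self)
    calc 2 * growthEnergy f C x₀ (x (n + 1))
        ≤ Real.exp (16 * C * (P.pt (n + 1) - P.pt n)) * (2 * growthEnergy f C x₀ (x n)) := by
          linarith [(hprox n n.lt_succ_self).growthEnergy_le h₀ hC (hmem n n.lt_succ_self)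
            (P.step_pos n) (hstep n n.lt_succ_self)]
      _ ≤ Real.exp (16 * C * (P.pt (n + 1) - P.pt n)) * Real.exp (16 * C * P.pt n) := by gcongr
      _ = Real.exp (16 * C * P.pt (n + 1)) := by rw [← Real.exp_add]; ring_nf

lemma IsScheme.drop_le {ε : ℝ} {P : TimePartition} {x : ℕ → X} (h : IsScheme S f ε P x)
    (h₀ : QuadraticLowerBound S f C (x 0)) (hC : 0 < C) (hε : 8 * C * ε ≤ 1) (n : ℕ) :
    f (x 0) - f (x n) ≤ 2 * C * Real.exp (16 * C * P.pt n) := by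
  have hstep (k : ℕ) : 8 * C * (P.pt (k + 1) - P.pt k) ≤ 1 :=
    le_trans (by gcongr; exact h.step_le k) hε
  have hdist := (h₀.sq_dist_le_growthEnergy hC (h.mem n)).trans
    (growthEnergy_le_exp h₀ hC rfl (fun k _ => h.mem k) (fun k _ => hstep k) fun k _ => h.prox k)
  have hone : 1 ≤ Real.exp (16 * C * P.pt n) := by
    have := P.pt_nonneg n
    exact Real.one_le_exp (by positivity)
  calc f (x 0) - f (x n) ≤ C * (1 + dist (x 0) (x n) ^ 2) := h₀ _ (h.mem n)
    _ ≤ C * (Real.exp (16 * C * P.pt n) + Real.exp (16 * C * P.pt n)) := by gcongr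
    _ = _ := by ring

end Energy

end Scheme

section Doubling

variable {X : Type*} [PseudoMetricSpace X] {δ ρ c : ℝ} {n m : ℕ} {a b : ℕ → ℝ} {x y : ℕ → X}

lemma exists_near_index (hstep : ∀ j, a (j + 1) ≤ a j + δ) {k : ℕ} (hk : 0 < k) {s : ℝ}
    (h0 : a 0 ≤ s) (hs : s ≤ a k) : ∃ j < k, a j ≤ s ∧ s ≤ a j + δ := by
  classical
  have hex : ∃ j, s ≤ a (j + 1) := ⟨k - 1, by rwa [Nat.sub_add_cancel hk]⟩
  refine ⟨Nat.find hex, ?_, ?_, (Nat.find_spec hex).trans (hstep _)⟩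
  · have : Nat.find hex ≤ k - 1 := Nat.find_min' hex (by rwa [Nat.sub_add_cancel hk])
    omega
  · rcases hj : Nat.find hex with _ | j
    · exact h0
    · exact (not_le.1 (Nat.find_min hex (hj ▸ j.lt_succ_self))).le

lemma dist_le_two_mul_of_diagonal (hstep : ∀ j, a (j + 1) ≤ a j + δ)
    (hmove : ∀ j k, j ≤ k → k ≤ n → a k - a j ≤ ρ + δ → dist (x j) (x k) ≤ c)
    {k : ℕ} (hk : 0 < k) (hkn : k ≤ n) {s : ℝ} (h0 : a 0 ≤ s) (hs : s ≤ a k) (hsρ : a k - s ≤ ρ)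
    {p : X} (hdiag : ∀ j < k, |a j - s| ≤ δ → dist (x j) p ≤ c) : dist (x k) p ≤ 2 * c := by
  obtain ⟨j, hjk, hjs, hsj⟩ := exists_near_index hstep hk h0 hs
  have hp := hdiag j hjk (abs_le.2 ⟨by linarith, by linarith⟩)
  have hx := hmove j k hjk.le hkn (by linarith)
  linarith [dist_triangle_left (x k) p (x j)]

/-- Two-parameter induction for a bound `B k l` on the pair `(x k, y l)` that propagates only
between points at distance at most `2 * c`: the bound itself keeps the two sequences close near
the diagonal `a k = b l`. -/
lemma doubling_induction {B : ℕ → ℕ → Prop} (ha : ∀ j, a (j + 1) ≤ a j + δ)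
    (hb : ∀ j, b (j + 1) ≤ b j + δ) (ha0 : ∀ l ≤ m, a 0 ≤ b l) (hb0 : ∀ k ≤ n, b 0 ≤ a k)
    (hx : ∀ j k, j ≤ k → k ≤ n → a k - a j ≤ ρ + δ → dist (x j) (x k) ≤ c)
    (hy : ∀ j k, j ≤ k → k ≤ m → b k - b j ≤ ρ + δ → dist (y j) (y k) ≤ c)
    (hfar : ∀ k ≤ n, ∀ l ≤ m, ρ ≤ |a k - b l| → B k l)
    (hleft : ∀ l ≤ m, |a 0 - b l| ≤ ρ → B 0 l) (hright : ∀ k ≤ n, |a k - b 0| ≤ ρ → B k 0)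
    (hdiag : ∀ k ≤ n, ∀ l ≤ m, |a k - b l| ≤ δ → B k l → dist (x k) (y l) ≤ c)
    (hB : ∀ k < n, ∀ l < m, dist (x (k + 1)) (y (l + 1)) ≤ 2 * c →
      B k (l + 1) → B (k + 1) l → B (k + 1) (l + 1))
    {k l : ℕ} (hk : k ≤ n) (hl : l ≤ m) : B k l := by
  induction hN : k + l using Nat.strong_induction_on generalizing k l with
  | _ N ih =>
  rcases le_total ρ |a k - b l| with hρ | hρ
  · exact hfar k hk l hl hρ
  rcases k with _ | k
  · exact hleft l hl hρ
  rcases l with _ | l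
  · exact hright _ hk hρ
  refine hB k hk l hl ?_ (ih _ (by omega) (by omega) hl rfl) (ih _ (by omega) hk (by omega) rfl)
  rcases le_total (b (l + 1)) (a (k + 1)) with hba | hab
  · refine dist_le_two_mul_of_diagonal ha hx k.succ_pos hk (ha0 _ hl) hba
      ((le_abs_self _).trans hρ) fun j hj hjl => ?_
    exact hdiag j (by omega) _ hl hjl (ih _ (by omega) (by omega) hl rfl)
  · rw [dist_comm]
    refine dist_le_two_mul_of_diagonal hb hy l.succ_pos hl (hb0 _ hk) hab
      ((le_abs_self _).trans (abs_sub_comm (b (l + 1)) _ ▸ hρ)) fun j hj hjk => ?_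
    rw [dist_comm]
    rw [abs_sub_comm] at hjk
    exact hdiag _ hk j (by omega) hjk (ih _ (by omega) hk (by omega) rfl)

end Doubling

section TimeChange

variable {lam ε : ℝ} {P : TimePartition}

/-- The discrete counterpart of `exp (λ t)` along a partition. -/
noncomputable def growthFactor (lam : ℝ) (P : TimePartition) (k : ℕ) : ℝ :=
  ∏ i ∈ Finset.range k, (1 + lam * (P.pt (i + 1) - P.pt i))

/-- The time change that turns the evolution variational inequality with parameter `λ`, weighted
by `growthFactor`, into one with parameter `0`. -/
noncomputable def rescaledTime (lam : ℝ) (P : TimePartition) (k : ℕ) : ℝ :=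
  ∑ i ∈ Finset.range k,
    (P.pt (i + 1) - P.pt i) / (1 + lam * (P.pt (i + 1) - P.pt i))

/-- A partition with steps at most `ε`, where `ε` is small compared to `1 / |λ|`. -/
structure IsFine (lam ε : ℝ) (P : TimePartition) : Prop where
  small : |lam| * ε ≤ 1 / 5
  step_le : ∀ k, P.pt (k + 1) - P.pt k ≤ ε

lemma growthFactor_succ (lam : ℝ) (P : TimePartition) (k : ℕ) :
    growthFactor lam P (k + 1) = growthFactor lam P k * (1 + lam * (P.pt (k + 1) - P.pt k)) :=
  Finset.prod_range_succ _ k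

lemma rescaledTime_zero (lam : ℝ) (P : TimePartition) : rescaledTime lam P 0 = 0 :=
  Finset.sum_range_zero _

lemma rescaledTime_succ_sub (lam : ℝ) (P : TimePartition) (k : ℕ) :
    rescaledTime lam P (k + 1) - rescaledTime lam P k =
      (P.pt (k + 1) - P.pt k) / (1 + lam * (P.pt (k + 1) - P.pt k)) := by
  rw [rescaledTime, Finset.sum_range_succ, ← rescaledTime, add_sub_cancel_left]

lemma exp_sub_two_mul_sq_le {u : ℝ} (hu : |u| ≤ 1 / 5) : Real.exp (u - 2 * u ^ 2) ≤ 1 + u := by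
  obtain ⟨h1, h2⟩ := abs_le.1 hu
  have hv : |u - 2 * u ^ 2| ≤ 1 := abs_le.2 ⟨by nlinarith, by nlinarith⟩
  have hexp := (abs_le.1 (Real.abs_exp_sub_one_sub_id_le hv)).2
  have hsq : (u - 2 * u ^ 2) ^ 2 ≤ 2 * u ^ 2 := by
    have : (1 - 2 * u) ^ 2 ≤ 2 := by nlinarith
    nlinarith [mul_le_mul_of_nonneg_left this (sq_nonneg u)]
  linarith

lemma IsFine.abs_mul_step_le (hP : IsFine lam ε P) (k : ℕ) :
    |lam * (P.pt (k + 1) - P.pt k)| ≤ 1 / 5 := by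
  rw [abs_mul, abs_of_pos (P.step_pos k)]
  exact (mul_le_mul_of_nonneg_left (hP.step_le k) (abs_nonneg lam)).trans hP.small

lemma IsFine.one_half_le_one_add_mul_step (hP : IsFine lam ε P) (k : ℕ) :
    1 / 2 ≤ 1 + lam * (P.pt (k + 1) - P.pt k) := by
  linarith [(abs_le.1 (hP.abs_mul_step_le k)).1]

lemma IsFine.growthFactor_pos (hP : IsFine lam ε P) (k : ℕ) :
    0 < growthFactor lam P k :=
  Finset.prod_pos fun i _ => by linarith [hP.one_half_le_one_add_mul_step i]

lemma IsFine.growthFactor_le_exp (hP : IsFine lam ε P) (k : ℕ) :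
    growthFactor lam P k ≤ Real.exp (|lam| * P.pt k) := by
  induction k with
  | zero => simp [growthFactor, P.pt_zero]
  | succ k ih =>
    have hfactor : 1 + lam * (P.pt (k + 1) - P.pt k) ≤
        Real.exp (|lam| * (P.pt (k + 1) - P.pt k)) := by
      have hlam := mul_le_mul_of_nonneg_right (le_abs_self lam) (P.step_pos k).le
      linarith [Real.add_one_le_exp (|lam| * (P.pt (k + 1) - P.pt k))]
    calc growthFactor lam P (k + 1)
        ≤ Real.exp (|lam| * P.pt k) * Real.exp (|lam| * (P.pt (k + 1) - P.pt k)) := by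
          rw [growthFactor_succ]
          exact mul_le_mul ih hfactor (by linarith [hP.one_half_le_one_add_mul_step k])
            (Real.exp_nonneg _)
      _ = Real.exp (|lam| * P.pt (k + 1)) := by rw [← Real.exp_add]; ring_nf

lemma IsFine.exp_le_growthFactor (hP : IsFine lam ε P) (k : ℕ) :
    Real.exp ((lam - 2 * lam ^ 2 * ε) * P.pt k) ≤ growthFactor lam P k := by
  induction k with
  | zero => simp [growthFactor, P.pt_zero]
  | succ k ih =>
    have hτ := P.step_pos k
    have hfactor : Real.exp ((lam - 2 * lam ^ 2 * ε) * (P.pt (k + 1) - P.pt k)) ≤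
        1 + lam * (P.pt (k + 1) - P.pt k) := by
      refine le_trans (Real.exp_le_exp.2 ?_) (exp_sub_two_mul_sq_le (hP.abs_mul_step_le k))
      have : lam ^ 2 * (P.pt (k + 1) - P.pt k) * (P.pt (k + 1) - P.pt k) ≤
          lam ^ 2 * (P.pt (k + 1) - P.pt k) * ε := by gcongr; exact hP.step_le k
      linarith
    calc Real.exp ((lam - 2 * lam ^ 2 * ε) * P.pt (k + 1))
        = Real.exp ((lam - 2 * lam ^ 2 * ε) * P.pt k) *
            Real.exp ((lam - 2 * lam ^ 2 * ε) * (P.pt (k + 1) - P.pt k)) := by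
          rw [← Real.exp_add]; ring_nf
      _ ≤ growthFactor lam P (k + 1) := by
          rw [growthFactor_succ]
          exact mul_le_mul ih hfactor (Real.exp_nonneg _) (hP.growthFactor_pos k).le

lemma IsFine.step_le_two_mul_rescaled_step (hP : IsFine lam ε P) (k : ℕ) :
    P.pt (k + 1) - P.pt k ≤ 2 * (rescaledTime lam P (k + 1) - rescaledTime lam P k) := by
  have hpos := hP.one_half_le_one_add_mul_step k
  have hle := (abs_le.1 (hP.abs_mul_step_le k)).2
  rw [rescaledTime_succ_sub, mul_div_assoc', le_div_iff₀ (by linarith), mul_comm]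
  exact mul_le_mul_of_nonneg_right (by linarith) (P.step_pos k).le

lemma IsFine.abs_rescaled_step_sub_step_le (hP : IsFine lam ε P) (k : ℕ) :
    |rescaledTime lam P (k + 1) - rescaledTime lam P k - (P.pt (k + 1) - P.pt k)| ≤
      2 * |lam| * ε * (P.pt (k + 1) - P.pt k) := by
  have hpos := hP.one_half_le_one_add_mul_step k
  have hτ := P.step_pos k
  have hτε := hP.step_le k
  rw [rescaledTime_succ_sub]
  set τ := P.pt (k + 1) - P.pt k
  have hpos' : 0 < 1 + lam * τ := by linarith
  have heq : τ / (1 + lam * τ) - τ = -(lam * τ * τ) / (1 + lam * τ) := by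
    rw [eq_div_iff hpos'.ne', sub_mul, div_mul_cancel₀ _ hpos'.ne']
    ring
  rw [heq, abs_div, abs_neg, abs_mul, abs_mul, abs_of_pos hτ, abs_of_pos hpos', div_le_iff₀ hpos']
  calc |lam| * τ * τ ≤ |lam| * ε * τ := by gcongr
    _ = 2 * |lam| * ε * τ * (1 / 2) := by ring
    _ ≤ 2 * |lam| * ε * τ * (1 + lam * τ) := by
        have : 0 ≤ ε := hτ.le.trans hτε
        gcongr

lemma IsFine.abs_rescaledTime_sub_le (hP : IsFine lam ε P) (k : ℕ) :
    |rescaledTime lam P k - P.pt k| ≤ 2 * |lam| * ε * P.pt k := by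
  induction k with
  | zero => simp [rescaledTime_zero, P.pt_zero]
  | succ k ih =>
    have hstep := hP.abs_rescaled_step_sub_step_le k
    rw [abs_le] at *
    constructor <;> linarith

lemma IsFine.sub_le_two_mul_rescaledTime_sub (hP : IsFine lam ε P) {j k : ℕ} (hjk : j ≤ k) :
    P.pt k - P.pt j ≤ 2 * (rescaledTime lam P k - rescaledTime lam P j) := by
  induction k, hjk using Nat.le_induction with
  | base => simp
  | succ k _ ih => linarith [hP.step_le_two_mul_rescaled_step k]

lemma IsFine.rescaledTime_nonneg (hP : IsFine lam ε P) (k : ℕ) :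
    0 ≤ rescaledTime lam P k := by
  have := hP.sub_le_two_mul_rescaledTime_sub k.zero_le
  rw [P.pt_zero, rescaledTime_zero] at this
  linarith [P.pt_nonneg k]

lemma IsFine.rescaledTime_le_two_mul (hP : IsFine lam ε P) (k : ℕ) :
    rescaledTime lam P k ≤ 2 * P.pt k := by
  have hsub := (abs_le.1 (hP.abs_rescaledTime_sub_le k)).2
  have := mul_le_mul_of_nonneg_right hP.small (P.pt_nonneg k)
  linarith [P.pt_nonneg k]

lemma IsFine.rescaled_step_le (hP : IsFine lam ε P) (k : ℕ) :
    rescaledTime lam P (k + 1) ≤ rescaledTime lam P k + 2 * ε := by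
  have hsub := (abs_le.1 (hP.abs_rescaled_step_sub_step_le k)).2
  have := mul_le_mul_of_nonneg_right hP.small (P.step_pos k).le
  linarith [P.step_pos k, hP.step_le k]

end TimeChange

/-- The discrete evolution variational inequality with parameter `λ`, required only for points at
mutual distance less than `r` and up to an error quadratic in the step length. -/
structure LocalEVI {X : Type*} [MetricSpace X] (S : Set X) (f : X → ℝ) (lam r K : ℝ) : Prop where
  radius_pos : 0 < r
  error_nonneg : 0 ≤ K
  le : ∀ τ : ℝ, 0 < τ → ∀ x ∈ S, ∀ z, IsProx S f τ x z → ∀ y ∈ S,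
    dist x z < r → dist x y < r → dist z y < r →
      (1 + lam * τ) * dist z y ^ 2 ≤ dist x y ^ 2 + 2 * τ * (f y - f z) + K * dist x z ^ 2

section Comparison

variable {X : Type*} [MetricSpace X] {S : Set X} {f : X → ℝ} {lam r K ε : ℝ}
  {P P' : TimePartition} {x y : ℕ → X}

lemma LocalEVI.weighted_step (hevi : LocalEVI S f lam r K) (hx : IsScheme S f ε P x)
    (hP : IsFine lam ε P) (k : ℕ) {p : X} (hp : p ∈ S) (hstep : dist (x k) (x (k + 1)) < r)
    (hk : dist (x k) p < r) (hk' : dist (x (k + 1)) p < r) :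
    growthFactor lam P (k + 1) * dist (x (k + 1)) p ^ 2 ≤
      growthFactor lam P k * dist (x k) p ^ 2 +
        (rescaledTime lam P (k + 1) - rescaledTime lam P k) * (growthFactor lam P (k + 1) *
          (2 * (f p - f (x (k + 1))) + 2 * K * (f (x k) - f (x (k + 1))))) := by
  have hτ := P.step_pos k
  have hmem := hx.mem k
  have hprox := hx.prox k
  have hpos := hP.growthFactor_pos k
  have hfactor := hP.one_half_le_one_add_mul_step k
  have hevi' := hevi.le _ hτ _ hmem _ hprox p hp hstep hk hk'
  have herror := mul_le_mul_of_nonneg_left (hprox.sq_dist_le hτ hmem) hevi.error_nonneg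
  rw [growthFactor_succ, rescaledTime_succ_sub]
  set τ := P.pt (k + 1) - P.pt k
  have hcancel : τ / (1 + lam * τ) * (1 + lam * τ) = τ := div_mul_cancel₀ _ (by linarith)
  calc growthFactor lam P k * (1 + lam * τ) * dist (x (k + 1)) p ^ 2
      = growthFactor lam P k * ((1 + lam * τ) * dist (x (k + 1)) p ^ 2) := mul_assoc _ _ _
    _ ≤ growthFactor lam P k * (dist (x k) p ^ 2 +
          τ * (2 * (f p - f (x (k + 1))) + 2 * K * (f (x k) - f (x (k + 1))))) := by
        gcongr
        linarith
    _ = _ := by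
        nth_rewrite 1 [← hcancel]
        ring

/-- The barrier of the doubling argument at times `a`, `b`, where `e` is the total drop of `f`
along both schemes. The term in `e` absorbs the error of the evolution variational inequality. -/
def barrier (D A Q δ a b e : ℝ) : ℝ :=
  D + A * ((a - b) ^ 2 + δ * (a + b)) + Q * δ * e

lemma le_barrier_of_step {D A Q δ a b e a' b' eₓ eᵧ u g : ℝ} (hA : 0 ≤ A) (hQ : 0 ≤ Q)
    (ha : a ≤ a') (haδ : a' ≤ a + δ) (hb : b ≤ b') (hbδ : b' ≤ b + δ) (hx : 0 ≤ eₓ) (hy : 0 ≤ eᵧ)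
    (hleft : u ≤ barrier D A Q δ a b' (e + eᵧ) + (a' - a) * (g + Q * eₓ))
    (hright : u ≤ barrier D A Q δ a' b (e + eₓ) + (b' - b) * (-g + Q * eᵧ)) :
    u ≤ barrier D A Q δ a' b' (e + eₓ + eᵧ) := by
  rw [barrier] at *
  have hAa : A * (a' - a) * (a' - a) ≤ A * (a' - a) * δ := by gcongr; linarith
  have hAb : A * (b' - b) * (b' - b) ≤ A * (b' - b) * δ := by gcongr; linarith
  have hQa : Q * eₓ * (a' - a) ≤ Q * eₓ * δ := by gcongr; linarith
  have hQb : Q * eᵧ * (b' - b) ≤ Q * eᵧ * δ := by gcongr; linarith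
  rcases le_total g (2 * A * (a' - b')) with hg | hg
  · linarith [mul_le_mul_of_nonneg_left hg (sub_nonneg.2 ha)]
  · linarith [mul_le_mul_of_nonneg_left hg (sub_nonneg.2 hb)]

/-- The squared distance in a doubled scheme, weighted by both growth factors. -/
noncomputable def weightedSqDist (lam : ℝ) (P P' : TimePartition) (x y : ℕ → X) (k l : ℕ) : ℝ :=
  growthFactor lam P k * growthFactor lam P' l * dist (x k) (y l) ^ 2

lemma weightedSqDist_comm (lam : ℝ) (P P' : TimePartition) (x y : ℕ → X) (k l : ℕ) :
    weightedSqDist lam P P' x y k l = weightedSqDist lam P' P y x l k := by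
  rw [weightedSqDist, weightedSqDist, dist_comm, mul_comm (growthFactor lam P k)]

lemma LocalEVI.weightedSqDist_succ_le (hevi : LocalEVI S f lam r K) (hx : IsScheme S f ε P x)
    (hP : IsFine lam ε P) (hP' : IsFine lam ε P') {k l : ℕ} (hy : y l ∈ S) {G : ℝ}
    (hG : growthFactor lam P (k + 1) * growthFactor lam P' l ≤ G)
    (hstep : dist (x k) (x (k + 1)) ≤ r / 4) (hxy : dist (x (k + 1)) (y l) ≤ 2 * (r / 4)) :
    weightedSqDist lam P P' x y (k + 1) l ≤ weightedSqDist lam P P' x y k l +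
      (rescaledTime lam P (k + 1) - rescaledTime lam P k) *
        (2 * (growthFactor lam P (k + 1) * growthFactor lam P' l) * (f (y l) - f (x (k + 1))) +
          2 * K * G * (f (x k) - f (x (k + 1)))) := by
  have hr := hevi.radius_pos
  have hK := hevi.error_nonneg
  have hq := hP'.growthFactor_pos l
  have hrescaled : 0 ≤ rescaledTime lam P (k + 1) - rescaledTime lam P k := by
    linarith [hP.step_le_two_mul_rescaled_step k, P.step_pos k]
  have hdrop := sub_nonneg.2 (hx.succ_le k)
  have hweighted := hevi.weighted_step hx hP k hy (by linarith)
    (by linarith [dist_triangle (x k) (x (k + 1)) (y l)]) (by linarith)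
  calc weightedSqDist lam P P' x y (k + 1) l
      = growthFactor lam P' l * (growthFactor lam P (k + 1) * dist (x (k + 1)) (y l) ^ 2) := by
        rw [weightedSqDist]; ring
    _ ≤ growthFactor lam P' l * (growthFactor lam P k * dist (x k) (y l) ^ 2 +
          (rescaledTime lam P (k + 1) - rescaledTime lam P k) * (growthFactor lam P (k + 1) *
            (2 * (f (y l) - f (x (k + 1))) + 2 * K * (f (x k) - f (x (k + 1)))))) := by gcongr
    _ = weightedSqDist lam P P' x y k l +
          (rescaledTime lam P (k + 1) - rescaledTime lam P k) *
            (2 * (growthFactor lam P (k + 1) * growthFactor lam P' l) *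
                (f (y l) - f (x (k + 1))) +
              2 * K * (growthFactor lam P (k + 1) * growthFactor lam P' l) *
                (f (x k) - f (x (k + 1)))) := by
        rw [weightedSqDist]; ring
    _ ≤ _ := by gcongr

lemma LocalEVI.weightedSqDist_le_barrier_succ (hevi : LocalEVI S f lam r K)
    (hx : IsScheme S f ε P x) (hy : IsScheme S f ε P' y) (hP : IsFine lam ε P)
    (hP' : IsFine lam ε P') {k l : ℕ} {D A G : ℝ} (hA : 0 ≤ A)
    (hG : growthFactor lam P (k + 1) * growthFactor lam P' (l + 1) ≤ G)
    (hxx : dist (x k) (x (k + 1)) ≤ r / 4) (hyy : dist (y l) (y (l + 1)) ≤ r / 4)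
    (hxy : dist (x (k + 1)) (y (l + 1)) ≤ 2 * (r / 4))
    (hleft : weightedSqDist lam P P' x y k (l + 1) ≤
      barrier D A (2 * K * G) (2 * ε) (rescaledTime lam P k) (rescaledTime lam P' (l + 1))
        (f (x 0) - f (x k) + (f (y 0) - f (y (l + 1)))))
    (hright : weightedSqDist lam P P' x y (k + 1) l ≤
      barrier D A (2 * K * G) (2 * ε) (rescaledTime lam P (k + 1)) (rescaledTime lam P' l)
        (f (x 0) - f (x (k + 1)) + (f (y 0) - f (y l)))) :
    weightedSqDist lam P P' x y (k + 1) (l + 1) ≤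
      barrier D A (2 * K * G) (2 * ε) (rescaledTime lam P (k + 1)) (rescaledTime lam P' (l + 1))
        (f (x 0) - f (x (k + 1)) + (f (y 0) - f (y (l + 1)))) := by
  have hQ : 0 ≤ 2 * K * G := mul_nonneg (mul_nonneg two_pos.le hevi.error_nonneg)
    ((mul_pos (hP.growthFactor_pos _) (hP'.growthFactor_pos _)).le.trans hG)
  have hx' := hevi.weightedSqDist_succ_le hx hP hP' (hy.mem (l + 1)) hG hxx hxy
  have hy' := hevi.weightedSqDist_succ_le hy hP' hP (hx.mem (k + 1))
    (mul_comm (growthFactor lam P (k + 1)) _ ▸ hG) hyy (dist_comm (x (k + 1)) _ ▸ hxy)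
  rw [weightedSqDist_comm lam P' P, weightedSqDist_comm lam P' P] at hy'
  rw [barrier] at hleft hright
  have hbarrier := le_barrier_of_step (u := weightedSqDist lam P P' x y (k + 1) (l + 1))
    (D := D) (A := A) (Q := 2 * K * G) (δ := 2 * ε)
    (e := f (x 0) - f (x k) + (f (y 0) - f (y l)))
    (g := 2 * (growthFactor lam P (k + 1) * growthFactor lam P' (l + 1)) *
      (f (y (l + 1)) - f (x (k + 1)))) hA hQ
    (by linarith [hP.step_le_two_mul_rescaled_step k, P.step_pos k]) (hP.rescaled_step_le k)
    (by linarith [hP'.step_le_two_mul_rescaled_step l, P'.step_pos l]) (hP'.rescaled_step_le l)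
    (sub_nonneg.2 (hx.succ_le k)) (sub_nonneg.2 (hy.succ_le l))
    (by rw [barrier]; linarith) (by rw [barrier]; linarith)
  rw [barrier] at hbarrier ⊢
  linarith

section Bounds

variable {n m : ℕ} {T M : ℝ}

lemma IsFine.growthFactor_mul_le_exp (hP : IsFine lam ε P) (hP' : IsFine lam ε P') {k l : ℕ}
    {a b : ℝ} (ha : P.pt k ≤ a) (hb : P'.pt l ≤ b) :
    growthFactor lam P k * growthFactor lam P' l ≤ Real.exp (|lam| * (a + b)) := by
  rw [mul_add, Real.exp_add]
  have := (hP'.growthFactor_pos l).le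
  gcongr
  · exact (hP.growthFactor_le_exp k).trans (by gcongr)
  · exact (hP'.growthFactor_le_exp l).trans (by gcongr)

lemma IsScheme.dist_le_of_rescaledTime_sub_le (hx : IsScheme S f ε P x) (hP : IsFine lam ε P)
    {s c : ℝ} (hM : f (x 0) - f (x n) ≤ M) (hc : 0 ≤ c) (hs : 2 * (2 * s) * M ≤ c ^ 2) {j k : ℕ}
    (hjk : j ≤ k) (hk : k ≤ n) (h : rescaledTime lam P k - rescaledTime lam P j ≤ s) :
    dist (x j) (x k) ≤ c :=
  (hx.dist_le_sqrt hM hjk hk (s := 2 * s)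
    (by linarith [hP.sub_le_two_mul_rescaledTime_sub hjk])).trans (Real.sqrt_le_iff.2 ⟨hc, hs⟩)

lemma weightedSqDist_le (hx : IsScheme S f ε P x) (hy : IsScheme S f ε P' y)
    (hP : IsFine lam ε P) (hP' : IsFine lam ε P') (hMx : f (x 0) - f (x n) ≤ M)
    (hMy : f (y 0) - f (y m) ≤ M) {k l : ℕ} (hk : k ≤ n) (hl : l ≤ m) {a b : ℝ} (ha : P.pt k ≤ a)
    (hb : P'.pt l ≤ b) :
    weightedSqDist lam P P' x y k l ≤
      Real.exp (|lam| * (a + b)) * (dist (x 0) (y 0) + √(2 * a * M) + √(2 * b * M)) ^ 2 := by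
  have hdx := hx.dist_le_sqrt hMx k.zero_le hk (s := a) (by rwa [P.pt_zero, sub_zero])
  have hdy := hy.dist_le_sqrt hMy l.zero_le hl (s := b) (by rwa [P'.pt_zero, sub_zero])
  have hdist : dist (x k) (y l) ≤ dist (x 0) (y 0) + √(2 * a * M) + √(2 * b * M) := by
    linarith [dist_triangle4 (x k) (x 0) (y 0) (y l), dist_comm (x k) (x 0)]
  have hfactor := hP.growthFactor_mul_le_exp hP' ha hb
  rw [weightedSqDist]
  gcongr

lemma sq_dist_le_exp_mul_weightedSqDist (hP : IsFine lam ε P) (hP' : IsFine lam ε P') {k l : ℕ}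
    (hk : P.pt k ≤ T) (hl : P'.pt l ≤ T) (x y : ℕ → X) :
    dist (x k) (y l) ^ 2 ≤ Real.exp (4 * |lam| * T) * weightedSqDist lam P P' x y k l := by
  have hlower {Q : TimePartition} (hQ : IsFine lam ε Q) {j : ℕ} (hj : Q.pt j ≤ T) :
      Real.exp (-(2 * |lam| * T)) ≤ growthFactor lam Q j := by
    refine le_trans (Real.exp_le_exp.2 ?_) (hQ.exp_le_growthFactor j)
    have hrate : -(2 * |lam|) ≤ lam - 2 * lam ^ 2 * ε := by
      have := mul_le_mul_of_nonneg_left hQ.small (abs_nonneg lam)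
      rw [← sq_abs lam]
      linarith [neg_abs_le lam, abs_nonneg lam]
    have := mul_le_mul_of_nonneg_left hj (abs_nonneg lam)
    linarith [mul_le_mul_of_nonneg_right hrate (Q.pt_nonneg j)]
  have hfactor : 1 ≤ Real.exp (4 * |lam| * T) *
      (growthFactor lam P k * growthFactor lam P' l) := by
    calc (1 : ℝ) = Real.exp (4 * |lam| * T) *
          (Real.exp (-(2 * |lam| * T)) * Real.exp (-(2 * |lam| * T))) := by
          rw [← Real.exp_add, ← Real.exp_add, ← Real.exp_zero]; ring_nf
      _ ≤ _ := mul_le_mul_of_nonneg_left (mul_le_mul (hlower hP hk) (hlower hP' hl)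
          (Real.exp_nonneg _) (hP.growthFactor_pos k).le) (Real.exp_nonneg _)
  calc dist (x k) (y l) ^ 2 = 1 * dist (x k) (y l) ^ 2 := (one_mul _).symm
    _ ≤ _ := by
      rw [weightedSqDist, ← mul_assoc]
      gcongr

lemma barrier_le {D A Q a b e : ℝ} (hA : 0 ≤ A) (hQ : 0 ≤ Q) (hε : 0 ≤ ε) (hab : a + b ≤ 4 * T)
    (he : e ≤ 2 * M) {w : ℝ} (hw : |a - b| ≤ w) :
    barrier D A Q (2 * ε) a b e ≤ D + (A * (w ^ 2 + 8 * T * ε) + 4 * Q * M * ε) := by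
  have hsq : (a - b) ^ 2 ≤ w ^ 2 := sq_le_sq' (abs_le.1 hw).1 (abs_le.1 hw).2
  have htime : A * ((a - b) ^ 2 + 2 * ε * (a + b)) ≤ A * (w ^ 2 + 2 * ε * (4 * T)) := by gcongr
  have hdrop : Q * (2 * ε) * e ≤ Q * (2 * ε) * (2 * M) := by gcongr
  rw [barrier]
  linarith

lemma le_barrier {D A Q δ a b e : ℝ} (hA : 0 ≤ A) (hQ : 0 ≤ Q) (hδ : 0 ≤ δ) (hab : 0 ≤ a + b)
    (he : 0 ≤ e) : D + A * (a - b) ^ 2 ≤ barrier D A Q δ a b e := by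
  have htime : 0 ≤ A * (δ * (a + b)) := by positivity
  have hdrop : 0 ≤ Q * δ * e := by positivity
  rw [barrier]
  linarith

end Bounds

end Comparison

section MainEstimate

variable {X : Type*} [MetricSpace X] {S : Set X} {f : X → ℝ} {lam r K ε : ℝ}
  {P P' : TimePartition} {x y : ℕ → X} {n m : ℕ} {T M ρ A D : ℝ}

lemma weightedSqDist_zero_left_le (hx : IsScheme S f ε P x) (hy : IsScheme S f ε P' y)
    (hP : IsFine lam ε P) (hP' : IsFine lam ε P') (hMx : f (x 0) - f (x n) ≤ M)
    (hMy : f (y 0) - f (y m) ≤ M) {l : ℕ} (hl : l ≤ m)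
    (h : |rescaledTime lam P 0 - rescaledTime lam P' l| ≤ ρ) :
    weightedSqDist lam P P' x y 0 l ≤
      Real.exp (|lam| * (2 * ρ)) * (dist (x 0) (y 0) + √(2 * (2 * ρ) * M)) ^ 2 := by
  rw [rescaledTime_zero, zero_sub, abs_neg, abs_of_nonneg (hP'.rescaledTime_nonneg l)] at h
  have htime := hP'.sub_le_two_mul_rescaledTime_sub l.zero_le
  rw [P'.pt_zero, rescaledTime_zero] at htime
  have := weightedSqDist_le hx hy hP hP' hMx hMy n.zero_le hl (a := 0) (b := 2 * ρ) P.pt_zero.le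
    (by linarith)
  simpa using this

lemma dist_le_of_weightedSqDist_le_barrier (hx : IsScheme S f ε P x) (hy : IsScheme S f ε P' y)
    (hP : IsFine lam ε P) (hP' : IsFine lam ε P') (hMx : f (x 0) - f (x n) ≤ M)
    (hMy : f (y 0) - f (y m) ≤ M) {Q w c : ℝ} (hA : 0 ≤ A) (hQ : 0 ≤ Q) (hε : 0 ≤ ε) {k l : ℕ}
    (htk : P.pt k ≤ T) (hsl : P'.pt l ≤ T) (hk : k ≤ n) (hl : l ≤ m) (hc : 0 ≤ c)
    (hclose : Real.exp (4 * |lam| * T) * (D + (A * (w ^ 2 + 8 * T * ε) + 4 * Q * M * ε)) ≤ c ^ 2)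
    (hkl : |rescaledTime lam P k - rescaledTime lam P' l| ≤ w)
    (hle : weightedSqDist lam P P' x y k l ≤
      barrier D A Q (2 * ε) (rescaledTime lam P k) (rescaledTime lam P' l)
        (f (x 0) - f (x k) + (f (y 0) - f (y l)))) :
    dist (x k) (y l) ≤ c := by
  have hbound := hle.trans (barrier_le (T := T) (M := M) hA hQ hε
    (by linarith [hP.rescaledTime_le_two_mul k, hP'.rescaledTime_le_two_mul l])
    (by linarith [hx.le_of_le hk, hy.le_of_le hl]) hkl)
  refine (abs_le_of_sq_le_sq' ?_ hc).2
  exact (sq_dist_le_exp_mul_weightedSqDist hP hP' htk hsl x y).trans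
    ((mul_le_mul_of_nonneg_left hbound (Real.exp_nonneg _)).trans hclose)

lemma LocalEVI.weightedSqDist_le_barrier (hevi : LocalEVI S f lam r K) (hx : IsScheme S f ε P x)
    (hy : IsScheme S f ε P' y) (hP : IsFine lam ε P) (hP' : IsFine lam ε P')
    (hTx : P.pt n ≤ T) (hTy : P'.pt m ≤ T) (hMx : f (x 0) - f (x n) ≤ M)
    (hMy : f (y 0) - f (y m) ≤ M) (hρ : 0 ≤ ρ) (hA : 0 ≤ A)
    (hD : Real.exp (|lam| * (2 * ρ)) * (dist (x 0) (y 0) + √(2 * (2 * ρ) * M)) ^ 2 ≤ D)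
    (hfar : Real.exp (|lam| * (T + T)) *
      (dist (x 0) (y 0) + √(2 * T * M) + √(2 * T * M)) ^ 2 ≤ A * ρ ^ 2)
    (hclose : Real.exp (4 * |lam| * T) * (D + (A * ((2 * ε) ^ 2 + 8 * T * ε) +
      4 * (2 * K * Real.exp (|lam| * (T + T))) * M * ε)) ≤ (r / 4) ^ 2)
    (hmove : 2 * (2 * (ρ + 2 * ε)) * M ≤ (r / 4) ^ 2) {k l : ℕ} (hk : k ≤ n) (hl : l ≤ m) :
    weightedSqDist lam P P' x y k l ≤
      barrier D A (2 * K * Real.exp (|lam| * (T + T))) (2 * ε) (rescaledTime lam P k)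
        (rescaledTime lam P' l) (f (x 0) - f (x k) + (f (y 0) - f (y l))) := by
  have hr4 : 0 ≤ r / 4 := by linarith [hevi.radius_pos]
  have hε : 0 ≤ ε := (P.step_pos 0).le.trans (hP.step_le 0)
  have hQ : 0 ≤ 2 * K * Real.exp (|lam| * (T + T)) :=
    mul_nonneg (mul_nonneg two_pos.le hevi.error_nonneg) (Real.exp_nonneg _)
  have hD0 : 0 ≤ D := le_trans (by positivity) hD
  have htk {k : ℕ} (hk : k ≤ n) : P.pt k ≤ T := (P.pt_strictMono.monotone hk).trans hTx
  have hsl {l : ℕ} (hl : l ≤ m) : P'.pt l ≤ T := (P'.pt_strictMono.monotone hl).trans hTy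
  have hbarrier {k l : ℕ} := le_barrier (D := D) hA hQ (by linarith : 0 ≤ 2 * ε)
    (add_nonneg (hP.rescaledTime_nonneg k) (hP'.rescaledTime_nonneg l))
    (add_nonneg (sub_nonneg.2 (hx.le_of_le k.zero_le)) (sub_nonneg.2 (hy.le_of_le l.zero_le)))
  have hDle {k l : ℕ} := (le_add_of_nonneg_right (mul_nonneg hA (sq_nonneg _))).trans
    (hbarrier (k := k) (l := l))
  have hmx {j k : ℕ} := hx.dist_le_of_rescaledTime_sub_le hP hMx hr4 hmove (j := j) (k := k)
  have hmy {j k : ℕ} := hy.dist_le_of_rescaledTime_sub_le hP' hMy hr4 hmove (j := j) (k := k)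
  refine doubling_induction (B := fun k l => weightedSqDist lam P P' x y k l ≤
      barrier D A (2 * K * Real.exp (|lam| * (T + T))) (2 * ε) (rescaledTime lam P k)
        (rescaledTime lam P' l) (f (x 0) - f (x k) + (f (y 0) - f (y l))))
    hP.rescaled_step_le hP'.rescaled_step_le
    (fun l _ => (rescaledTime_zero lam P).trans_le (hP'.rescaledTime_nonneg l))
    (fun k _ => (rescaledTime_zero lam P').trans_le (hP.rescaledTime_nonneg k))
    (fun j k => hmx) (fun j k => hmy) ?far ?left ?right ?diag ?step hk hl
  case far =>
    intro k hk l hl hkl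
    have hsq : A * ρ ^ 2 ≤ A * (rescaledTime lam P k - rescaledTime lam P' l) ^ 2 := by
      rw [← sq_abs (rescaledTime lam P k - _)]
      gcongr
    linarith [hbarrier (k := k) (l := l),
      weightedSqDist_le hx hy hP hP' hMx hMy hk hl (htk hk) (hsl hl), hD0]
  case left =>
    exact fun l hl h => (weightedSqDist_zero_left_le hx hy hP hP' hMx hMy hl h).trans
      (hD.trans hDle)
  case right =>
    intro k hk h
    rw [weightedSqDist_comm]
    rw [abs_sub_comm] at h
    rw [dist_comm] at hD
    exact (weightedSqDist_zero_left_le hy hx hP' hP hMy hMx hk h).trans (hD.trans hDle)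
  case diag =>
    intro k hk l hl hkl hle
    exact dist_le_of_weightedSqDist_le_barrier hx hy hP hP' hMx hMy hA hQ hε (htk hk) (hsl hl) hk
      hl hr4 hclose hkl hle
  case step =>
    intro k hk l hl hxy hleft hright
    exact hevi.weightedSqDist_le_barrier_succ hx hy hP hP' hA
      (hP.growthFactor_mul_le_exp hP' (htk hk) (hsl hl))
      (hmx k.le_succ hk (by linarith [hP.rescaled_step_le k]))
      (hmy l.le_succ hl (by linarith [hP'.rescaled_step_le l])) hxy hleft hright

end MainEstimate

section Asymptotics

variable {X : Type*} [MetricSpace X] {S : Set X} {f : X → ℝ} {lam r K ε : ℝ}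
  {P P' : TimePartition} {x y : ℕ → X} {n m : ℕ} {T M ρ A D : ℝ}

lemma IsFine.abs_rescaledTime_sub_rescaledTime_le (hP : IsFine lam ε P) (hP' : IsFine lam ε P')
    {t : ℝ} (hn : P.pt n ∈ Set.Icc t (t + ε)) (hm : P'.pt m ∈ Set.Icc t (t + ε))
    (hT : t + ε ≤ T) :
    |rescaledTime lam P n - rescaledTime lam P' m| ≤ (1 + 4 * |lam| * T) * ε := by
  have hε : 0 ≤ ε := (P.step_pos 0).le.trans (hP.step_le 0)
  have hrescaled {Q : TimePartition} (hQ : IsFine lam ε Q) {k : ℕ}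
      (hk : Q.pt k ∈ Set.Icc t (t + ε)) :
      |rescaledTime lam Q k - Q.pt k| ≤ 2 * |lam| * ε * T :=
    (hQ.abs_rescaledTime_sub_le k).trans
      (mul_le_mul_of_nonneg_left (hk.2.trans hT) (by positivity))
  have hx := abs_le.1 (hrescaled hP hn)
  have hy := abs_le.1 (hrescaled hP' hm)
  obtain ⟨hn1, hn2⟩ := hn
  obtain ⟨hm1, hm2⟩ := hm
  exact abs_le.2 ⟨by linarith, by linarith⟩

lemma exp_mul_sq_dist_le_exp_mul_weightedSqDist (hP : IsFine lam ε P) (hP' : IsFine lam ε P')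
    {t : ℝ} (hn : P.pt n ∈ Set.Icc t (t + ε)) (hm : P'.pt m ∈ Set.Icc t (t + ε))
    (hT : t + ε ≤ T) (x y : ℕ → X) :
    Real.exp (2 * lam * t) * dist (x n) (y m) ^ 2 ≤
      Real.exp ((2 * |lam| + 4 * lam ^ 2 * T) * ε) * weightedSqDist lam P P' x y n m := by
  have hε : 0 ≤ ε := (P.step_pos 0).le.trans (hP.step_le 0)
  have hexponent {Q : TimePartition} {k : ℕ} (hk : Q.pt k ∈ Set.Icc t (t + ε)) :
      lam * t ≤ (|lam| + 2 * lam ^ 2 * T) * ε + (lam - 2 * lam ^ 2 * ε) * Q.pt k := by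
    have hshift : -(|lam| * ε) ≤ lam * (Q.pt k - t) := by
      have hlam := mul_le_mul_of_nonneg_right (neg_abs_le lam) (sub_nonneg.2 hk.1)
      have := mul_le_mul_of_nonneg_left (sub_le_iff_le_add'.2 hk.2) (abs_nonneg lam)
      linarith
    have hquad := mul_le_mul_of_nonneg_left (hk.2.trans hT)
      (by positivity : 0 ≤ 2 * lam ^ 2 * ε)
    linarith
  calc Real.exp (2 * lam * t) * dist (x n) (y m) ^ 2
      ≤ (Real.exp ((2 * |lam| + 4 * lam ^ 2 * T) * ε) *
          (Real.exp ((lam - 2 * lam ^ 2 * ε) * P.pt n) *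
            Real.exp ((lam - 2 * lam ^ 2 * ε) * P'.pt m))) * dist (x n) (y m) ^ 2 := by
        rw [← Real.exp_add, ← Real.exp_add]
        gcongr
        linarith [hexponent hn, hexponent hm]
    _ ≤ (Real.exp ((2 * |lam| + 4 * lam ^ 2 * T) * ε) *
          (growthFactor lam P n * growthFactor lam P' m)) * dist (x n) (y m) ^ 2 := by
        have := (hP.growthFactor_pos n).le
        gcongr
        · exact hP.exp_le_growthFactor n
        · exact hP'.exp_le_growthFactor m
    _ = _ := by rw [weightedSqDist, mul_assoc, mul_assoc]

lemma LocalEVI.exp_mul_sq_dist_le (hevi : LocalEVI S f lam r K) (hx : IsScheme S f ε P x)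
    (hy : IsScheme S f ε P' y) (hlam : |lam| * ε ≤ 1 / 5) {t : ℝ}
    (hn : P.pt n ∈ Set.Icc t (t + ε)) (hm : P'.pt m ∈ Set.Icc t (t + ε)) (hT : t + ε ≤ T)
    (hMx : f (x 0) - f (x n) ≤ M) (hMy : f (y 0) - f (y m) ≤ M) (hρ : 0 ≤ ρ) (hA : 0 ≤ A)
    (hD : Real.exp (|lam| * (2 * ρ)) * (dist (x 0) (y 0) + √(2 * (2 * ρ) * M)) ^ 2 ≤ D)
    (hfar : Real.exp (|lam| * (T + T)) *
      (dist (x 0) (y 0) + √(2 * T * M) + √(2 * T * M)) ^ 2 ≤ A * ρ ^ 2)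
    (hclose : Real.exp (4 * |lam| * T) * (D + (A * ((2 * ε) ^ 2 + 8 * T * ε) +
      4 * (2 * K * Real.exp (|lam| * (T + T))) * M * ε)) ≤ (r / 4) ^ 2)
    (hmove : 2 * (2 * (ρ + 2 * ε)) * M ≤ (r / 4) ^ 2) :
    Real.exp (2 * lam * t) * dist (x n) (y m) ^ 2 ≤
      Real.exp ((2 * |lam| + 4 * lam ^ 2 * T) * ε) *
        (D + (A * (((1 + 4 * |lam| * T) * ε) ^ 2 + 8 * T * ε) +
          4 * (2 * K * Real.exp (|lam| * (T + T))) * M * ε)) := by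
  have hP : IsFine lam ε P := ⟨hlam, hx.step_le⟩
  have hP' : IsFine lam ε P' := ⟨hlam, hy.step_le⟩
  have hTn := hn.2.trans hT
  have hTm := hm.2.trans hT
  have hw := hevi.weightedSqDist_le_barrier hx hy hP hP' hTn hTm hMx hMy hρ hA hD hfar hclose
    hmove le_rfl le_rfl
  refine (exp_mul_sq_dist_le_exp_mul_weightedSqDist hP hP' hn hm hT x y).trans ?_
  refine mul_le_mul_of_nonneg_left (hw.trans (barrier_le hA ?_ ?_ ?_ ?_ ?_)) (Real.exp_nonneg _)
  · exact mul_nonneg (mul_nonneg two_pos.le hevi.error_nonneg) (Real.exp_nonneg _)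
  · exact (P.step_pos 0).le.trans (hP.step_le 0)
  · linarith [hP.rescaledTime_le_two_mul n, hP'.rescaledTime_le_two_mul m]
  · linarith
  · exact hP.abs_rescaledTime_sub_rescaledTime_le hP' hn hm hT

lemma exists_boundary_layer {d₀ c δ : ℝ} (hc : 0 < c)
    (hclose : Real.exp (4 * |lam| * T) * d₀ ^ 2 < c ^ 2) (hδ : 0 < δ) (M : ℝ) :
    ∃ ρ > 0, Real.exp (|lam| * (2 * ρ)) * (d₀ + √(2 * (2 * ρ) * M)) ^ 2 < d₀ ^ 2 + δ ∧
      Real.exp (4 * |lam| * T) *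
        (Real.exp (|lam| * (2 * ρ)) * (d₀ + √(2 * (2 * ρ) * M)) ^ 2) < c ^ 2 ∧
      2 * (2 * ρ) * M < c ^ 2 := by
  have hD : Continuous fun ρ : ℝ =>
      Real.exp (|lam| * (2 * ρ)) * (d₀ + √(2 * (2 * ρ) * M)) ^ 2 := by fun_prop
  have hev := ((hD.tendsto 0).eventually_lt_const (by simpa using hδ : _ < d₀ ^ 2 + δ)).and
    ((((hD.const_mul (Real.exp (4 * |lam| * T))).tendsto 0).eventually_lt_const
      (by simpa using hclose : _ < c ^ 2)).and
    (((by fun_prop : Continuous fun ρ : ℝ => 2 * (2 * ρ) * M).tendsto 0).eventually_lt_const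
      (by simpa using pow_pos hc 2 : _ < c ^ 2)))
  obtain ⟨ρ, h, hρ⟩ := ((hev.filter_mono nhdsWithin_le_nhds).and
    (self_mem_nhdsWithin : ∀ᶠ ρ : ℝ in 𝓝[>] 0, ρ ∈ Set.Ioi 0)).exists
  exact ⟨ρ, hρ, h⟩

lemma exp_two_mul_mul_sq_lt {d c u : ℝ} (hd : 0 ≤ d) (h : d < c * Real.exp (-u)) :
    Real.exp (2 * u) * d ^ 2 < c ^ 2 :=
  calc Real.exp (2 * u) * d ^ 2 < Real.exp (2 * u) * (c * Real.exp (-u)) ^ 2 := by gcongr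
    _ = c ^ 2 := by
      rw [mul_pow, ← Real.exp_nat_mul, mul_left_comm, ← Real.exp_add, Nat.cast_two, mul_neg,
        add_neg_cancel, Real.exp_zero, mul_one]

lemma LocalEVI.eventually_exp_mul_sq_dist_le (hevi : LocalEVI S f lam r K) {x₀ y₀ : X} {C : ℝ}
    (hC : 0 < C) (hCx : QuadraticLowerBound S f C x₀) (hCy : QuadraticLowerBound S f C y₀)
    {t : ℝ} (ht : 0 ≤ t) (hdist : dist x₀ y₀ < r / 4 * Real.exp (-(2 * |lam| * (t + 1))))
    {δ : ℝ} (hδ : 0 < δ) :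
    ∀ᶠ ε in 𝓝[>] 0, ∀ (P P' : TimePartition) (x y : ℕ → X) (n m : ℕ),
      IsScheme S f ε P x → IsScheme S f ε P' y → x 0 = x₀ → y 0 = y₀ →
      P.pt n ∈ Set.Icc t (t + ε) → P'.pt m ∈ Set.Icc t (t + ε) →
        Real.exp (2 * lam * t) * dist (x n) (y m) ^ 2 ≤ dist x₀ y₀ ^ 2 + δ := by
  set T := t + 1
  set M := 2 * C * Real.exp (16 * C * T)
  set R := Real.exp (|lam| * (T + T)) * (dist x₀ y₀ + √(2 * T * M) + √(2 * T * M)) ^ 2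
  set Q := 2 * K * Real.exp (|lam| * (T + T))
  have hr : 0 < r / 4 := by linarith [hevi.radius_pos]
  have hclose : Real.exp (4 * |lam| * T) * dist x₀ y₀ ^ 2 < (r / 4) ^ 2 := by
    convert exp_two_mul_mul_sq_lt dist_nonneg hdist using 3
    ring
  obtain ⟨ρ, hρ, hDδ, hDr, hmove⟩ := exists_boundary_layer hr hclose hδ M
  set D := Real.exp (|lam| * (2 * ρ)) * (dist x₀ y₀ + √(2 * (2 * ρ) * M)) ^ 2
  have eventually_lt {F : ℝ → ℝ} (hF : Continuous F) {b : ℝ} (h : F 0 < b) :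
      ∀ᶠ ε in 𝓝[>] 0, F ε < b :=
    ((hF.tendsto 0).mono_left nhdsWithin_le_nhds).eventually_lt_const h
  filter_upwards [eventually_lt (F := fun ε => |lam| * ε) (b := 1 / 5) (by fun_prop) (by simp),
    eventually_lt (F := fun ε => 8 * C * ε) (b := 1) (by fun_prop) (by simp),
    eventually_lt (F := fun ε => ε) (b := 1) (by fun_prop) one_pos,
    eventually_lt (F := fun ε => Real.exp (4 * |lam| * T) *
      (D + (R / ρ ^ 2 * ((2 * ε) ^ 2 + 8 * T * ε) + 4 * Q * M * ε))) (by fun_prop)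
      (by simpa using hDr),
    eventually_lt (F := fun ε => 2 * (2 * (ρ + 2 * ε)) * M) (by fun_prop) (by simpa using hmove),
    eventually_lt (F := fun ε => Real.exp ((2 * |lam| + 4 * lam ^ 2 * T) * ε) *
      (D + (R / ρ ^ 2 * (((1 + 4 * |lam| * T) * ε) ^ 2 + 8 * T * ε) + 4 * Q * M * ε)))
      (by fun_prop) (by simpa using hDδ)]
    with ε hlam hCε hε hclose hmove hlimit P P' x y n m hx hy hx₀ hy₀ hn hm
  subst hx₀ hy₀
  have hdrop {P : TimePartition} {x : ℕ → X} {n : ℕ} (hx : IsScheme S f ε P x)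
      (h₀ : QuadraticLowerBound S f C (x 0)) (hn : P.pt n ∈ Set.Icc t (t + ε)) :
      f (x 0) - f (x n) ≤ M :=
    (hx.drop_le h₀ hC hCε.le n).trans
      (mul_le_mul_of_nonneg_left (Real.exp_le_exp.2 (by gcongr; linarith [hn.2])) (by positivity))
  exact (hevi.exp_mul_sq_dist_le hx hy hlam.le hn hm (by linarith) (hdrop hx hCx hn)
    (hdrop hy hCy hm) hρ.le (by positivity) le_rfl (div_mul_cancel₀ R (by positivity)).ge
    hclose.le hmove.le).trans hlimit.le

end Asymptotics

section Existence

/-- Solvability of the resolvent problem for small steps, uniformly over the points at which `f` has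
a given quadratic lower bound. -/
def HasProx {X : Type*} [MetricSpace X] (S : Set X) (f : X → ℝ) : Prop :=
  ∀ C : ℝ, ∃ τ₀ > 0, ∀ x ∈ S, QuadraticLowerBound S f C x →
    ∀ τ, 0 < τ → τ < τ₀ → ∃ z, IsProx S f τ x z

lemma exists_timePartition {g : ℕ → ℝ} (hg : ∀ N, 0 < g N) :
    ∃ P : TimePartition, ∀ k, P.pt (k + 1) - P.pt k = g ⌊P.pt k⌋₊ := by
  let t : ℕ → ℝ := fun k => Nat.rec 0 (fun _ a => a + g ⌊a⌋₊) k
  have hsucc (k : ℕ) : t (k + 1) = t k + g ⌊t k⌋₊ := rfl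
  have hmono : StrictMono t := strictMono_nat_of_lt_succ fun k => by linarith [hsucc k, hg ⌊t k⌋₊]
  suffices htop : Tendsto t atTop atTop from
    ⟨⟨t, rfl, hmono, htop⟩, fun k => sub_eq_of_eq_add' (hsucc k)⟩
  refine tendsto_atTop_atTop_of_monotone hmono.monotone fun B => ?_
  by_contra! hB
  obtain ⟨j, -, hj⟩ := Finset.exists_min_image (Finset.range (⌊B⌋₊ + 1)) g ⟨0, by simp⟩
  have hgrowth (k : ℕ) : k * g j ≤ t k := by
    induction k with
    | zero => simp [t]
    | succ k ih =>
      have hstep := hj ⌊t k⌋₊ (Finset.mem_range_succ_iff.2 (Nat.floor_mono (hB k).le))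
      rw [hsucc]
      push_cast
      linarith
  obtain ⟨k, hk⟩ := exists_nat_gt (B / g j)
  rw [div_lt_iff₀ (hg j)] at hk
  linarith [hgrowth k, hB k]

variable {X : Type*} [MetricSpace X] {S : Set X} {f : X → ℝ} {C : ℝ} {x₀ : X}

lemma QuadraticLowerBound.of_prefix (h₀ : QuadraticLowerBound S f C x₀) (hC : 0 < C)
    {P : TimePartition} {x : ℕ → X} (hx₀ : x 0 = x₀) {n : ℕ} (hmem : ∀ k ≤ n, x k ∈ S)
    (hstep : ∀ k < n, 8 * C * (P.pt (k + 1) - P.pt k) ≤ 1)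
    (hprox : ∀ k < n, IsProx S f (P.pt (k + 1) - P.pt k) (x k) (x (k + 1))) :
    QuadraticLowerBound S f (2 * C * (1 + Real.exp (16 * C * P.pt n))) (x n) := by
  have hdist : dist x₀ (x n) ^ 2 ≤ Real.exp (16 * C * P.pt n) :=
    (h₀.sq_dist_le_growthEnergy hC (hmem n le_rfl)).trans
      (growthEnergy_le_exp h₀ hC hx₀ (fun k hk => hmem k hk.le) hstep hprox)
  have hle (k : ℕ) (hk : k ≤ n) : f (x k) ≤ f x₀ := by
    induction k with
    | zero => rw [hx₀]
    | succ k ih => exact ((hprox k hk).le (P.step_pos k) (hmem k (by omega))).trans (ih (by omega))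
  intro w hw
  have htriangle : dist x₀ w ^ 2 ≤ 2 * (dist x₀ (x n) ^ 2 + dist (x n) w ^ 2) :=
    (pow_le_pow_left₀ dist_nonneg (dist_triangle _ _ _) 2).trans add_sq_le
  calc f (x n) - f w ≤ C * (1 + dist x₀ w ^ 2) := by linarith [h₀ w hw, hle n le_rfl]
    _ ≤ C * (1 + 2 * (Real.exp (16 * C * P.pt n) + dist (x n) w ^ 2)) := by gcongr; linarith
    _ ≤ _ := by
      have : 0 ≤ C * (1 + 2 * Real.exp (16 * C * P.pt n) * dist (x n) w ^ 2) := by positivity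
      linarith

lemma HasProx.exists_isScheme (hprox : HasProx S f) (hC : 0 < C)
    (h₀ : QuadraticLowerBound S f C x₀) (hx₀ : x₀ ∈ S) {ε : ℝ} (hε : 0 < ε) :
    ∃ (P : TimePartition) (x : ℕ → X), IsScheme S f ε P x ∧ x 0 = x₀ := by
  choose τ hτ0 hτ using fun N : ℕ => hprox (2 * C * (1 + Real.exp (16 * C * (N + 1))))
  obtain ⟨P, hP⟩ := exists_timePartition (g := fun N => min (τ N / 2) (min ε (1 / (8 * C))))
    fun N => lt_min (half_pos (hτ0 N)) (lt_min hε (by positivity))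
  have hstep (k : ℕ) : 8 * C * (P.pt (k + 1) - P.pt k) ≤ 1 := by
    rw [← le_div_iff₀' (by positivity), hP]
    exact (min_le_right _ _).trans (min_le_right _ _)
  let x : ℕ → X := fun k =>
    Nat.rec x₀ (fun k a => @Classical.epsilon X ⟨x₀⟩ (IsProx S f (P.pt (k + 1) - P.pt k) a)) k
  have hx (k : ℕ) : IsProx S f (P.pt (k + 1) - P.pt k) (x k) (x (k + 1)) := by
    induction k using Nat.strong_induction_on with
    | _ n ih =>
      have hmem : ∀ k ≤ n, x k ∈ S
        | 0, _ => hx₀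
        | k + 1, hk => (ih k hk).1
      have hbound := h₀.of_prefix hC rfl hmem (fun k _ => hstep k) ih
      refine Classical.epsilon_spec (hτ ⌊P.pt n⌋₊ (x n) (hmem n le_rfl) (fun w hw => ?_) _
        (P.step_pos n) ?_)
      · refine (hbound w hw).trans ?_
        gcongr
        exact (Nat.lt_floor_add_one _).le
      · rw [hP]
        exact (min_le_left _ _).trans_lt (half_lt_self (hτ0 _))
  refine ⟨P, x, ⟨hx₀, fun k => ?_, hx⟩, rfl⟩
  rw [hP]
  exact (min_le_right _ _).trans (min_le_left _ _)

end Existence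

section Conversion

variable {X : Type*} {φ : X → EReal}

/-- The real-valued function that agrees with `φ` on `dom φ` if `φ` avoids `⊥`; elsewhere its values
are the junk values of `EReal.toReal`. -/
def finitePart (φ : X → EReal) (x : X) : ℝ := (φ x).toReal

lemma coe_finitePart (hbot : ∀ x, φ x ≠ ⊥) {x : X} (hx : x ∈ dom φ) :
    (finitePart φ x : EReal) = φ x :=
  EReal.coe_toReal hx (hbot x)

lemma mem_dom_of_le_coe {x : X} {a : ℝ} (h : φ x ≤ a) : x ∈ dom φ :=
  ne_top_of_le_ne_top (EReal.coe_ne_top a) h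

lemma finitePart_le (hbot : ∀ x, φ x ≠ ⊥) {x : X} {a : ℝ} (h : φ x ≤ a) : finitePart φ x ≤ a := by
  rwa [← coe_finitePart hbot (mem_dom_of_le_coe h), EReal.coe_le_coe_iff] at h

lemma coe_finitePart_add_le_iff (hbot : ∀ x, φ x ≠ ⊥) {z w : X} (hz : z ∈ dom φ)
    (hw : w ∈ dom φ) (a b : ℝ) : φ z + a ≤ φ w + b ↔ finitePart φ z + a ≤ finitePart φ w + b := by
  rw [← coe_finitePart hbot hz, ← coe_finitePart hbot hw, ← EReal.coe_add, ← EReal.coe_add,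
    EReal.coe_le_coe_iff]

variable [MetricSpace X] {τ : ℝ} {x z : X}

lemma isProx_of_mem_minimizers (hbot : ∀ x, φ x ≠ ⊥) (hx : x ∈ dom φ)
    (hz : z ∈ minimizers φ τ x) : IsProx (dom φ) (finitePart φ) τ x z := by
  have hmin (w : X) : φ z + ((dist x z ^ 2 / (2 * τ) : ℝ) : EReal) ≤
      φ w + ((dist x w ^ 2 / (2 * τ) : ℝ) : EReal) :=
    (show _ = moreauYosida φ τ x from hz).trans_le (iInf_le _ w)
  have hzd : z ∈ dom φ := by
    intro htop
    have hx' := hmin x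
    rw [htop, EReal.top_add_coe, ← coe_finitePart hbot hx, ← EReal.coe_add] at hx'
    exact EReal.coe_ne_top _ (top_le_iff.1 hx')
  exact ⟨hzd, fun w hw => (coe_finitePart_add_le_iff hbot hzd hw _ _).1 (hmin w)⟩

lemma IsProx.mem_minimizers (hbot : ∀ x, φ x ≠ ⊥) (hz : IsProx (dom φ) (finitePart φ) τ x z) :
    z ∈ minimizers φ τ x := by
  refine le_antisymm (le_iInf fun w => ?_) (iInf_le _ z)
  by_cases hw : w ∈ dom φ
  · exact (coe_finitePart_add_le_iff hbot hz.1 hw _ _).2 (hz.2 w hw)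
  · rw [not_not.1 hw, EReal.top_add_coe]
    exact le_top

lemma TimePartition.mesh_le_ofReal_iff (P : TimePartition) {ε : ℝ} (hε : 0 ≤ ε) :
    P.mesh ≤ ENNReal.ofReal ε ↔ ∀ k, P.pt (k + 1) - P.pt k ≤ ε := by
  simp only [mesh, iSup_le_iff, ENNReal.ofReal_le_ofReal_iff hε]

lemma TimePartition.pt_interp_mem_Icc (P : TimePartition) {ε : ℝ} (hε : 0 ≤ ε)
    (hstep : ∀ k, P.pt (k + 1) - P.pt k ≤ ε) (t : ℝ≥0) :
    P.interp P.pt t ∈ Set.Icc (t : ℝ) (t + ε) := by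
  have hne : {k | (t : ℝ) ≤ P.pt k}.Nonempty := (P.pt_tendsto.eventually_ge_atTop (t : ℝ)).exists
  refine ⟨Nat.sInf_mem hne, ?_⟩
  rw [interp]
  rcases hk : sInf {k | (t : ℝ) ≤ P.pt k} with _ | k
  · rw [P.pt_zero]
    positivity
  · have hlt : k < sInf {k | (t : ℝ) ≤ P.pt k} := by omega
    have hkt : P.pt k < t := not_le.1 (Nat.notMem_of_lt_sInf hlt)
    linarith [hstep k]

lemma IsDiscreteSolution.isScheme (hbot : ∀ x, φ x ≠ ⊥) {P : TimePartition} {x₀ : X} {x : ℕ → X}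
    (h : IsDiscreteSolution φ P x₀ x) (hx₀ : x₀ ∈ dom φ) {ε : ℝ} (hε : 0 ≤ ε)
    (hmesh : P.mesh ≤ ENNReal.ofReal ε) : IsScheme (dom φ) (finitePart φ) ε P x := by
  have hmem (k : ℕ) : x k ∈ dom φ := by
    induction k with
    | zero => rwa [h.1]
    | succ k ih => exact (isProx_of_mem_minimizers hbot ih (h.2 k)).1
  exact ⟨hmem 0, (P.mesh_le_ofReal_iff hε).1 hmesh,
    fun k => isProx_of_mem_minimizers hbot (hmem k) (h.2 k)⟩

end Conversion

section GradientCurve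

variable {X : Type*} [MetricSpace X] {φ : X → EReal} {lam r K : ℝ} {x₀ y₀ : X}

lemma QuadraticLowerBound.mono {S : Set X} {f : X → ℝ} {C C' : ℝ}
    (h : QuadraticLowerBound S f C x₀) (hC : C ≤ C') : QuadraticLowerBound S f C' x₀ :=
  fun w hw => (h w hw).trans (by gcongr)

lemma LocalEVI.exists_exp_mul_sq_dist_interp_le (hbot : ∀ x, φ x ≠ ⊥)
    (hevi : LocalEVI (dom φ) (finitePart φ) lam r K)
    (hgrowth : ∀ x ∈ dom φ, ∃ C > 0, QuadraticLowerBound (dom φ) (finitePart φ) C x)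
    (hx₀ : x₀ ∈ dom φ) (hy₀ : y₀ ∈ dom φ) (t : ℝ≥0)
    (hdist : dist x₀ y₀ < r / 4 * Real.exp (-(2 * |lam| * (t + 1)))) {δ : ℝ} (hδ : 0 < δ) :
    ∃ ε > 0, ∀ (P P' : TimePartition) (x y : ℕ → X), IsDiscreteSolution φ P x₀ x →
      IsDiscreteSolution φ P' y₀ y → P.mesh ≤ ENNReal.ofReal ε → P'.mesh ≤ ENNReal.ofReal ε →
        Real.exp (2 * lam * t) * dist (P.interp x t) (P'.interp y t) ^ 2 ≤ dist x₀ y₀ ^ 2 + δ := by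
  obtain ⟨C, hC, hCx⟩ := hgrowth x₀ hx₀
  obtain ⟨C', -, hCy⟩ := hgrowth y₀ hy₀
  obtain ⟨ε, hεδ, hε⟩ := ((hevi.eventually_exp_mul_sq_dist_le (lt_max_of_lt_left hC)
    (hCx.mono (le_max_left C C')) (hCy.mono (le_max_right C C')) t.2 hdist hδ).and
      (self_mem_nhdsWithin : ∀ᶠ ε : ℝ in 𝓝[>] 0, 0 < ε)).exists
  refine ⟨ε, hε, fun P P' x y hx hy hP hP' => ?_⟩
  have hx' := hx.isScheme hbot hx₀ hε.le hP
  have hy' := hy.isScheme hbot hy₀ hε.le hP'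
  exact hεδ P P' x y _ _ hx' hy' hx.1 hy.1 (P.pt_interp_mem_Icc hε.le hx'.step_le t)
    (P'.pt_interp_mem_Icc hε.le hy'.step_le t)

lemma IsGradientCurve.dist_le_of_dist_lt (hbot : ∀ x, φ x ≠ ⊥)
    (hevi : LocalEVI (dom φ) (finitePart φ) lam r K)
    (hgrowth : ∀ x ∈ dom φ, ∃ C > 0, QuadraticLowerBound (dom φ) (finitePart φ) C x)
    (hx₀ : x₀ ∈ dom φ) (hy₀ : y₀ ∈ dom φ) {ξ ζ : ℝ≥0 → X} (hξ : IsGradientCurve φ x₀ ξ)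
    (hζ : IsGradientCurve φ y₀ ζ) (t : ℝ≥0)
    (hdist : dist x₀ y₀ < r / 4 * Real.exp (-(2 * |lam| * (t + 1)))) :
    dist (ξ t) (ζ t) ≤ Real.exp (-lam * t) * dist x₀ y₀ := by
  obtain ⟨P, x, hPmesh, hx, hPt⟩ := hξ
  obtain ⟨P', y, hPmesh', hy, hPt'⟩ := hζ
  suffices hsq : Real.exp (2 * (lam * t)) * dist (ξ t) (ζ t) ^ 2 ≤ dist x₀ y₀ ^ 2 by
    have hinv : Real.exp (-lam * t) ^ 2 * Real.exp (2 * (lam * t)) = 1 := by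
      rw [← Real.exp_nat_mul, ← Real.exp_add, ← Real.exp_zero]
      push_cast
      ring_nf
    refine (abs_le_of_sq_le_sq' ?_ (by positivity)).2
    calc dist (ξ t) (ζ t) ^ 2
        = Real.exp (-lam * t) ^ 2 * (Real.exp (2 * (lam * t)) * dist (ξ t) (ζ t) ^ 2) := by
          rw [← mul_assoc, hinv, one_mul]
      _ ≤ Real.exp (-lam * t) ^ 2 * dist x₀ y₀ ^ 2 := by gcongr
      _ = _ := (mul_pow _ _ _).symm
  refine le_of_forall_pos_le_add fun δ hδ => ?_
  obtain ⟨ε, hε, hle⟩ :=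
    hevi.exists_exp_mul_sq_dist_interp_le hbot hgrowth hx₀ hy₀ t hdist hδ
  have hε' : 0 < ENNReal.ofReal ε := ENNReal.ofReal_pos.2 hε
  rw [← mul_assoc]
  refine le_of_tendsto (((hPt t).dist (hPt' t)).pow 2 |>.const_mul (Real.exp (2 * lam * t))) ?_
  filter_upwards [hPmesh.eventually_le_const hε', hPmesh'.eventually_le_const hε'] with i hi hi'
  exact hle _ _ _ _ (hx i) (hy i) hi hi'

lemma exists_isGradientCurve [CompleteSpace X] (hbot : ∀ x, φ x ≠ ⊥)
    (hevi : LocalEVI (dom φ) (finitePart φ) lam r K)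
    (hgrowth : ∀ x ∈ dom φ, ∃ C > 0, QuadraticLowerBound (dom φ) (finitePart φ) C x)
    (hprox : HasProx (dom φ) (finitePart φ)) (hx₀ : x₀ ∈ dom φ) :
    ∃ ξ : ℝ≥0 → X, IsGradientCurve φ x₀ ξ := by
  obtain ⟨C, hC, hC₀⟩ := hgrowth x₀ hx₀
  obtain ⟨u, -, hupos, hu⟩ := exists_seq_strictAnti_tendsto (0 : ℝ)
  choose P x hscheme hxzero using fun i => hprox.exists_isScheme hC hC₀ hx₀ (hupos i)
  have hsol (i : ℕ) : IsDiscreteSolution φ (P i) x₀ (x i) :=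
    ⟨hxzero i, fun k => ((hscheme i).prox k).mem_minimizers hbot⟩
  have hmesh : Tendsto (fun i => (P i).mesh) atTop (𝓝 0) := by
    refine tendsto_of_tendsto_of_tendsto_of_le_of_le tendsto_const_nhds
      (by simpa using ENNReal.tendsto_ofReal hu) (fun _ => zero_le) fun i => ?_
    exact ((P i).mesh_le_ofReal_iff (hupos i).le).2 (hscheme i).step_le
  have hcauchy (t : ℝ≥0) : CauchySeq fun i => (P i).interp (x i) t := by
    refine Metric.cauchySeq_iff.2 fun η hη => ?_
    have hr := hevi.radius_pos
    obtain ⟨ε, hε, hle⟩ := hevi.exists_exp_mul_sq_dist_interp_le hbot hgrowth hx₀ hx₀ t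
      (by rw [dist_self]; positivity) (δ := Real.exp (2 * lam * t) * (η / 2) ^ 2) (by positivity)
    obtain ⟨N, hN⟩ :=
      eventually_atTop.1 (hmesh.eventually_le_const (ENNReal.ofReal_pos.2 hε))
    refine ⟨N, fun i hi j hj => ?_⟩
    have hij := hle _ _ _ _ (hsol i) (hsol j) (hN i hi) (hN j hj)
    rw [dist_self, zero_pow two_ne_zero, zero_add] at hij
    have hhalf := (abs_le_of_sq_le_sq' (le_of_mul_le_mul_left hij (Real.exp_pos _))
      (half_pos hη).le).2
    linarith
  choose ξ hξ using fun t => cauchySeq_tendsto_of_complete (hcauchy t)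
  exact ⟨ξ, P, x, hmesh, hsol, hξ⟩

lemma IsGradientCurve.eq (hbot : ∀ x, φ x ≠ ⊥) (hevi : LocalEVI (dom φ) (finitePart φ) lam r K)
    (hgrowth : ∀ x ∈ dom φ, ∃ C > 0, QuadraticLowerBound (dom φ) (finitePart φ) C x)
    (hx₀ : x₀ ∈ dom φ) {ξ ζ : ℝ≥0 → X} (hξ : IsGradientCurve φ x₀ ξ)
    (hζ : IsGradientCurve φ x₀ ζ) : ξ = ζ := by
  funext t
  have hr := hevi.radius_pos
  have hdist := hξ.dist_le_of_dist_lt hbot hevi hgrowth hx₀ hx₀ hζ t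
    (by rw [dist_self]; positivity)
  rwa [dist_self, mul_zero, dist_le_zero] at hdist

lemma IsMinGeodesic.dist_image_le {Y : Type*} [PseudoMetricSpace Y] {γ : ℝ → X} {x y : X}
    (hγ : IsMinGeodesic γ x y) {S : Set X} (hγS : ∀ t ∈ Set.Icc (0 : ℝ) 1, γ t ∈ S) {F : X → Y}
    {L ρ : ℝ} (hρ : 0 < ρ)
    (hF : ∀ p ∈ S, ∀ q ∈ S, dist p q < ρ → dist (F p) (F q) ≤ L * dist p q) :
    dist (F x) (F y) ≤ L * dist x y := by
  obtain ⟨hγ0, hγ1, hγd⟩ := hγ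
  obtain ⟨N, hN⟩ := exists_nat_gt (dist x y / ρ)
  have hN0 : (0 : ℝ) < N := (by positivity : 0 ≤ dist x y / ρ).trans_lt hN
  have hmem {k : ℕ} (hk : k ≤ N) : (k / N : ℝ) ∈ Set.Icc (0 : ℝ) 1 :=
    ⟨by positivity, (div_le_one hN0).2 (by exact_mod_cast hk)⟩
  have hstep {k : ℕ} (hk : k < N) :
      dist (γ (k / N)) (γ ((k + 1 : ℕ) / N)) = dist x y / N := by
    rw [hγd _ (hmem hk.le) _ (hmem hk), ← sub_div, Nat.cast_succ, sub_add_cancel_left, abs_div,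
      abs_neg, abs_one, Nat.abs_cast, one_div_mul_eq_div]
  have hchain := dist_le_range_sum_of_dist_le (f := fun k : ℕ => F (γ (k / N)))
    (d := fun _ => L * (dist x y / N)) N fun {k} hk =>
      hstep hk ▸ hF _ (hγS _ (hmem hk.le)) _ (hγS _ (hmem hk))
        (by rw [hstep hk]; exact (div_lt_comm₀ hρ hN0).1 hN)
  rw [Finset.sum_const, Finset.card_range, nsmul_eq_mul, mul_left_comm,
    mul_div_cancel₀ _ hN0.ne'] at hchain
  simpa [hN0.ne', hγ0, hγ1] using hchain

lemma LocalEVI.dist_gradientCurve_le [CompleteSpace X] (hbot : ∀ x, φ x ≠ ⊥)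
    (hevi : LocalEVI (dom φ) (finitePart φ) lam r K)
    (hgrowth : ∀ x ∈ dom φ, ∃ C > 0, QuadraticLowerBound (dom φ) (finitePart φ) C x)
    (hprox : HasProx (dom φ) (finitePart φ)) {γ : ℝ → X} (hγ : IsMinGeodesic γ x₀ y₀)
    (hγdom : ∀ t ∈ Set.Icc (0 : ℝ) 1, γ t ∈ dom φ) {ξ ζ : ℝ≥0 → X} (hξ : IsGradientCurve φ x₀ ξ)
    (hζ : IsGradientCurve φ y₀ ζ) (t : ℝ≥0) :
    dist (ξ t) (ζ t) ≤ Real.exp (-lam * t) * dist x₀ y₀ := by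
  have : Nonempty X := ⟨x₀⟩
  have hr := hevi.radius_pos
  have hx₀ : x₀ ∈ dom φ := hγ.1 ▸ hγdom 0 (by simp)
  have hy₀ : y₀ ∈ dom φ := hγ.2.1 ▸ hγdom 1 (by simp)
  choose! G hG using fun p (hp : p ∈ dom φ) =>
    exists_isGradientCurve hbot hevi hgrowth hprox hp
  rw [hξ.eq hbot hevi hgrowth hx₀ (hG x₀ hx₀), hζ.eq hbot hevi hgrowth hy₀ (hG y₀ hy₀)]
  exact hγ.dist_image_le hγdom (F := fun p => G p t) (by positivity) fun p hp q hq hpq =>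
    (hG p hp).dist_le_of_dist_lt hbot hevi hgrowth hp hq (hG q hq) t hpq

end GradientCurve

section SemiConvex

variable {X : Type*} [MetricSpace X] {S : Set X} {f : X → ℝ} {φ : X → EReal} {lam : ℝ}
  {Γ : Set (ℝ → X)} {γ : ℝ → X} {x y z : X}

/-- A minimal geodesic from `x` to `y` that runs in `S` and along which `f` is `lam`-convex, in the
sense of the inequality against the chord from `x` to `y`. -/
structure IsConvexGeodesic (S : Set X) (f : X → ℝ) (lam : ℝ) (γ : ℝ → X) (x y : X) : Prop where
  isMinGeodesic : IsMinGeodesic γ x y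
  mem : ∀ t ∈ Set.Icc (0 : ℝ) 1, γ t ∈ S
  le : ∀ t ∈ Set.Icc (0 : ℝ) 1,
    f (γ t) ≤ (1 - t) * f x + t * f y - lam / 2 * (1 - t) * t * dist x y ^ 2

lemma IsMinGeodesic.dist_left (hγ : IsMinGeodesic γ x y) {t : ℝ} (ht : t ∈ Set.Icc (0 : ℝ) 1) :
    dist x (γ t) = t * dist x y := by
  have h := hγ.2.2 0 (by simp) t ht
  rwa [hγ.1, zero_sub, abs_neg, abs_of_nonneg ht.1] at h

lemma IsLambdaConvex.exists_isConvexGeodesic (hbot : ∀ x, φ x ≠ ⊥) (h : IsLambdaConvex Γ lam φ)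
    (hx : x ∈ dom φ) (hy : y ∈ dom φ) :
    ∃ γ ∈ Γ, IsConvexGeodesic (dom φ) (finitePart φ) lam γ x y := by
  obtain ⟨γ, hγΓ, hγ, hconv⟩ := h x hx y hy
  exact ⟨γ, hγΓ, hγ, fun t ht => mem_dom_of_le_coe (hconv t ht),
    fun t ht => finitePart_le hbot (hconv t ht)⟩

lemma mul_le_abs_mul_of_le {a b c : ℝ} (hb : 0 ≤ b) (hbc : b ≤ c) : a * b ≤ |a| * c :=
  (mul_le_mul_of_nonneg_right (le_abs_self a) hb).trans
    (mul_le_mul_of_nonneg_left hbc (abs_nonneg a))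

lemma IsConvexGeodesic.sub_le_of_forall_dist_le (h : IsConvexGeodesic S f lam γ x y) {σ : ℝ}
    (hσ : 0 < σ) (hσxy : σ ≤ dist x y) (hf : ∀ w ∈ S, dist x w ≤ σ → f x - 1 ≤ f w) :
    f x - f y ≤ dist x y / σ + |lam| / 2 * dist x y ^ 2 := by
  have hpos : 0 < dist x y := hσ.trans_le hσxy
  have ht0 : 0 < σ / dist x y := by positivity
  have hmem : σ / dist x y ∈ Set.Icc (0 : ℝ) 1 := ⟨ht0.le, (div_le_one hpos).2 hσxy⟩
  have hball := hf _ (h.mem _ hmem)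
    (by rw [h.isMinGeodesic.dist_left hmem, div_mul_cancel₀ _ hpos.ne'])
  have hle := hball.trans (h.le _ hmem)
  set t := σ / dist x y with ht
  have hone : t * (dist x y / σ) = 1 := by
    rw [ht]
    field_simp
  have hquad : -lam * ((1 - t) * t * dist x y ^ 2) ≤ |-lam| * (t * dist x y ^ 2) := by
    refine mul_le_abs_mul_of_le ?_ ?_
    · have := hmem.2
      exact mul_nonneg (mul_nonneg (by linarith) ht0.le) (sq_nonneg _)
    · gcongr
      nlinarith
  rw [abs_neg] at hquad
  refine le_of_mul_le_mul_left ?_ ht0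
  linarith

lemma IsLambdaConvex.exists_quadraticLowerBound (hbot : ∀ x, φ x ≠ ⊥)
    (hlsc : LowerSemicontinuous φ) (h : IsLambdaConvex Γ lam φ) (hx : x ∈ dom φ) :
    ∃ C > 0, QuadraticLowerBound (dom φ) (finitePart φ) C x := by
  have hlt : ((finitePart φ x - 1 : ℝ) : EReal) < φ x := by
    rw [← coe_finitePart hbot hx, EReal.coe_lt_coe_iff]
    linarith
  obtain ⟨ρ, hρ, hball⟩ := Metric.eventually_nhds_iff.1 (hlsc x _ hlt)
  have hnear (w : X) (hw : w ∈ dom φ) (hxw : dist x w < ρ) :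
      finitePart φ x - 1 ≤ finitePart φ w := by
    have hle := (hball (by rwa [dist_comm])).le
    rwa [← coe_finitePart hbot hw, EReal.coe_le_coe_iff] at hle
  have hC : 0 < 1 + 2 / ρ + |lam| / 2 := by positivity
  refine ⟨_, hC, fun w hw => ?_⟩
  rcases lt_or_ge (dist x w) ρ with hxw | hxw
  · have hone : 1 ≤ (1 + 2 / ρ + |lam| / 2) * (1 + dist x w ^ 2) :=
      one_le_mul_of_one_le_of_one_le
        (by rw [add_assoc]; exact le_add_of_nonneg_right (by positivity))
        (le_add_of_nonneg_right (sq_nonneg _))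
    linarith [hnear w hw hxw]
  · obtain ⟨γ, -, hγ⟩ := h.exists_isConvexGeodesic hbot hx hw
    have hsub := hγ.sub_le_of_forall_dist_le (half_pos hρ) (by linarith)
      fun v hv hxv => hnear v hv (by linarith)
    have hlin : dist x w ≤ 1 + dist x w ^ 2 := by nlinarith [sq_nonneg (dist x w - 1)]
    calc finitePart φ x - finitePart φ w
        ≤ dist x w / (ρ / 2) + |lam| / 2 * dist x w ^ 2 := hsub
      _ = 2 / ρ * dist x w + |lam| / 2 * dist x w ^ 2 := by field_simp
      _ ≤ 2 / ρ * (1 + dist x w ^ 2) + (1 + |lam| / 2) * (1 + dist x w ^ 2) := by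
          gcongr <;> linarith
      _ = _ := by ring

lemma IsProx.mul_sq_dist_le_of_tendsto {τ l : ℝ} (hz : IsProx S f τ x z) (hτ : 0 < τ)
    (hγ : IsConvexGeodesic S f lam γ z y) {u : ℝ → ℝ}
    (hu : ∀ s ∈ Set.Ioo (0 : ℝ) 1, dist x (γ s) ^ 2 - dist x z ^ 2 ≤ s * u s)
    (hl : Tendsto u (𝓝[>] 0) (𝓝 l)) :
    lam * τ * dist z y ^ 2 ≤ 2 * τ * (f y - f z) + l := by
  have hcont : Tendsto (fun s : ℝ => lam * τ * (1 - s) * dist z y ^ 2) (𝓝[>] 0)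
      (𝓝 (lam * τ * dist z y ^ 2)) :=
    tendsto_nhdsWithin_of_tendsto_nhds
      (Continuous.tendsto' (by fun_prop) _ _ (by rw [sub_zero, mul_one]))
  refine le_of_tendsto_of_tendsto hcont (hl.const_add _) ?_
  filter_upwards [Ioo_mem_nhdsGT (zero_lt_one' ℝ)] with s hs
  have hmem : s ∈ Set.Icc (0 : ℝ) 1 := Set.Ioo_subset_Icc_self hs
  have hmin : 2 * τ * (f z - f (γ s)) ≤ dist x (γ s) ^ 2 - dist x z ^ 2 := by
    have h := hz.2 _ (hγ.mem s hmem)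
    rw [← sub_le_sub_iff_right (f (γ s)), add_sub_right_comm, ← le_sub_iff_add_le,
      add_sub_cancel_left, ← sub_div, le_div_iff₀ (by positivity)] at h
    linarith
  refine le_of_mul_le_mul_left ?_ hs.1
  have hconv := mul_le_mul_of_nonneg_left (hγ.le s hmem) (by positivity : 0 ≤ 2 * τ)
  linarith [hu s hs]

lemma SqDistCommutes.localEVI {K r : ℝ} (hbot : ∀ x, φ x ≠ ⊥) (hconv : IsLambdaConvex Γ lam φ)
    (hK : SqDistConvex Γ K) (hcomm : SqDistCommutes Γ) (hr : 0 < r) :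
    LocalEVI (dom φ) (finitePart φ) lam r (|K| / 2) := by
  refine ⟨hr, by positivity, fun τ hτ x hx z hz y hy _ _ _ => ?_⟩
  obtain ⟨γ, hγΓ, hγ⟩ := hconv.exists_isConvexGeodesic hbot hz.1 hy
  obtain ⟨η, hηΓ, hη⟩ := hconv.exists_isConvexGeodesic hbot hz.1 hx
  obtain ⟨l, hlγ, hlη⟩ := hcomm γ hγΓ η hηΓ z y x hγ.isMinGeodesic hη.isMinGeodesic
  have hfirst := hz.mul_sq_dist_le_of_tendsto hτ hγ (fun s hs => by
    rw [mul_div_cancel₀ _ hs.1.ne', dist_comm x, dist_comm x]) hlγ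
  have hl : l ≤ dist x y ^ 2 - dist z y ^ 2 + |K| / 2 * dist x z ^ 2 := by
    refine le_of_tendsto hlη ?_
    filter_upwards [Ioo_mem_nhdsGT (zero_lt_one' ℝ)] with t ht
    have hsq := hK η hηΓ z x hη.isMinGeodesic y t (Set.Ioo_subset_Icc_self ht)
    have herr : -K * ((1 - t) * t * dist z x ^ 2) ≤ |-K| * (t * dist z x ^ 2) := by
      have ht0 := ht.1.le
      refine mul_le_abs_mul_of_le ?_ ?_
      · exact mul_nonneg (mul_nonneg (sub_nonneg.2 ht.2.le) ht0) (sq_nonneg _)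
      · gcongr
        exact mul_le_of_le_one_left ht0 (by linarith)
    rw [abs_neg] at herr
    rw [div_le_iff₀ ht.1, dist_comm x z]
    linarith
  linarith

lemma IsCoercive.hasProx (hbot : ∀ x, φ x ≠ ⊥) (h : IsCoercive φ) :
    HasProx (dom φ) (finitePart φ) := by
  obtain ⟨τs, hτs, hmin⟩ := h
  refine fun _ => ⟨τs, hτs, fun x hx _ τ hτ hlt => ?_⟩
  obtain ⟨z, hz⟩ := (hmin x τ hτ hlt).2
  exact ⟨z, isProx_of_mem_minimizers hbot hx hz⟩

end SemiConvex

lemma mul_sinc (x : ℝ) : x * Real.sinc x = Real.sin x := by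
  rcases eq_or_ne x 0 with rfl | hx
  · simp
  · rw [Real.sinc_of_ne_zero hx, mul_div_cancel₀ _ hx]

lemma sinc_pos {x : ℝ} (h0 : 0 ≤ x) (hπ : x < Real.pi) : 0 < Real.sinc x := by
  rcases h0.eq_or_lt with rfl | h0
  · simp
  · rw [Real.sinc_of_ne_zero h0.ne']
    exact div_pos (Real.sin_pos_of_pos_of_lt_pi h0 hπ) h0

lemma antitoneOn_sinc : AntitoneOn Real.sinc (Set.Icc 0 Real.pi) := by
  intro x hx y hy hxy
  rcases hx.1.eq_or_lt with rfl | hx0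
  · simpa using Real.sinc_le_one y
  have hslope {u : ℝ} (hu : 0 < u) : Real.sinc u = slope Real.sin 0 u := by
    rw [Real.sinc_of_ne_zero hu.ne', slope_def_field, Real.sin_zero, sub_zero, sub_zero]
  rw [hslope hx0, hslope (hx0.trans_le hxy)]
  exact strictConcaveOn_sin_Icc.concaveOn.antitoneOn_slope_gt (by simp [Real.pi_nonneg])
    ⟨hx, hx0⟩ ⟨hy, hx0.trans_le hxy⟩ hxy

lemma cos_le_sinc {x : ℝ} (h0 : 0 ≤ x) (hπ : x ≤ Real.pi) : Real.cos x ≤ Real.sinc x := by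
  rcases h0.eq_or_lt with rfl | h0
  · simp
  have hslope := strictConcaveOn_sin_Icc.concaveOn.le_slope_of_hasDerivAt
    (by simp [Real.pi_nonneg]) ⟨h0.le, hπ⟩ h0 (Real.hasDerivAt_sin x)
  rwa [slope_def_field, Real.sin_zero, sub_zero, sub_zero, ← Real.sinc_of_ne_zero h0.ne'] at hslope

lemma two_mul_cos_sub_cos_le {b c : ℝ} (hb : b ∈ Set.Icc 0 Real.pi) (hc : c ∈ Set.Icc 0 Real.pi) :
    2 * (Real.cos b - Real.cos c) ≤ Real.sinc b * (c ^ 2 - b ^ 2) := by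
  let g : ℝ → ℝ := fun u => 2 * Real.cos u + Real.sinc b * u ^ 2
  have hderiv (u : ℝ) : deriv g u = 2 * (u * (Real.sinc b - Real.sinc u)) := by
    have h : HasDerivAt g (2 * -Real.sin u + Real.sinc b * (2 * u)) u := by
      simpa using ((Real.hasDerivAt_cos u).const_mul 2).fun_add ((hasDerivAt_pow 2 u).const_mul _)
    rw [h.deriv, ← mul_sinc u]
    ring
  have hdiff : Differentiable ℝ g := by fun_prop
  have hmin : IsMinOn g (Set.Icc 0 Real.pi) b := by
    refine isMinOn_Icc_of_anti_mono
      (antitoneOn_of_deriv_nonpos (convex_Icc _ _) hdiff.continuous.continuousOn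
        hdiff.differentiableOn fun u hu => ?_)
      (monotoneOn_of_deriv_nonneg (convex_Icc _ _) hdiff.continuous.continuousOn
        hdiff.differentiableOn fun u hu => ?_) <;>
      rw [interior_Icc] at hu <;> rw [hderiv]
    · have hsinc := antitoneOn_sinc ⟨hu.1.le, hu.2.le.trans hb.2⟩ hb hu.2.le
      exact mul_nonpos_of_nonneg_of_nonpos zero_le_two
        (mul_nonpos_of_nonneg_of_nonpos hu.1.le (sub_nonpos.2 hsinc))
    · have hu0 : 0 ≤ u := hb.1.trans hu.1.le
      have hsinc := antitoneOn_sinc hb ⟨hu0, hu.2.le⟩ hu.1.le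
      exact mul_nonneg zero_le_two (mul_nonneg hu0 (sub_nonneg.2 hsinc))
  have hle : g b ≤ g c := hmin hc
  simp only [g] at hle
  linarith

section CAT1

lemma sin_add_smul_eq {E : Type*} [NormedAddCommGroup E] [InnerProductSpace ℝ E]
    {b c w : E} {p q : ℝ} (hb : ‖b‖ = 1) (hc : ‖c‖ = 1) (hw : ‖w‖ = 1)
    (hbc : inner ℝ b c = Real.cos (p + q)) (hwb : inner ℝ w b = Real.cos q)
    (hwc : inner ℝ w c = Real.cos p) :
    Real.sin (p + q) • w = Real.sin p • b + Real.sin q • c := by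
  rw [← sub_eq_zero, ← norm_eq_zero, ← sq_eq_zero_iff, norm_sub_sq_real, norm_add_sq_real,
    inner_add_right]
  simp only [inner_smul_left, inner_smul_right, norm_smul, mul_pow, hb, hc, hw, hbc, hwb, hwc,
    Real.norm_eq_abs, sq_abs, RCLike.conj_to_real]
  rw [Real.sin_add, Real.cos_add]
  have hp := Real.sin_sq p
  have hq := Real.sin_sq q
  ring_nf
  rw [hp, hq]
  ring

lemma inner_eq_cos_sphereDist {a b : E3} (ha : ‖a‖ = 1) (hb : ‖b‖ = 1) :
    inner ℝ a b = Real.cos (sphereDist a b) := by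
  rw [sphereDist, InnerProductGeometry.cos_angle, ha, hb, mul_one, div_one]

lemma IsSphereGeodesic.sin_mul_cos_sphereDist {σ : ℝ → E3} {a b c : E3}
    (hσ : IsSphereGeodesic σ b c) (ha : ‖a‖ = 1) {t : ℝ} (ht : t ∈ Set.Icc (0 : ℝ) 1) :
    Real.sin (sphereDist b c) * Real.cos (sphereDist a (σ t)) =
      Real.sin ((1 - t) * sphereDist b c) * Real.cos (sphereDist a b) +
        Real.sin (t * sphereDist b c) * Real.cos (sphereDist a c) := by
  obtain ⟨rfl, rfl, hnorm, hdist⟩ := hσ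
  have h0 : (0 : ℝ) ∈ Set.Icc (0 : ℝ) 1 := by simp
  have h1 : (1 : ℝ) ∈ Set.Icc (0 : ℝ) 1 := by simp
  have hunit {s : ℝ} (hs : s ∈ Set.Icc (0 : ℝ) 1) : ‖σ s‖ = 1 :=
    mem_sphere_zero_iff_norm.1 (hnorm s hs)
  have hleft : sphereDist (σ t) (σ 0) = t * sphereDist (σ 0) (σ 1) := by
    rw [hdist t ht 0 h0, sub_zero, abs_of_nonneg ht.1]
  have hright : sphereDist (σ t) (σ 1) = (1 - t) * sphereDist (σ 0) (σ 1) := by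
    rw [hdist t ht 1 h1, abs_sub_comm, abs_of_nonneg (sub_nonneg.2 ht.2)]
  have hadd : (1 - t) * sphereDist (σ 0) (σ 1) + t * sphereDist (σ 0) (σ 1) =
      sphereDist (σ 0) (σ 1) := by ring
  have hslerp := sin_add_smul_eq (hunit h0) (hunit h1) (hunit ht)
    (p := (1 - t) * sphereDist (σ 0) (σ 1)) (q := t * sphereDist (σ 0) (σ 1))
    (by rw [hadd, inner_eq_cos_sphereDist (hunit h0) (hunit h1)])
    (by rw [← hleft, inner_eq_cos_sphereDist (hunit ht) (hunit h0)])
    (by rw [← hright, inner_eq_cos_sphereDist (hunit ht) (hunit h1)])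
  rw [hadd] at hslerp
  simpa only [inner_add_right, inner_smul_right, inner_eq_cos_sphereDist ha (hunit h0),
    inner_eq_cos_sphereDist ha (hunit h1), inner_eq_cos_sphereDist ha (hunit ht)]
    using congrArg (inner ℝ a) hslerp

/-- The cosine of the distance in the unit sphere from the vertex `x` of a triangle `xyz` to the
point at parameter `s` of the side `yz`, where the side `yz` has length `b` and the sides `xy` and
`xz` have lengths `a` and `c`. -/
noncomputable def sphericalCos (a b c s : ℝ) : ℝ :=
  (Real.sin ((1 - s) * b) * Real.cos a + Real.sin (s * b) * Real.cos c) / Real.sin b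

lemma sphericalCos_zero (a : ℝ) {b : ℝ} (c : ℝ) (hb : Real.sin b ≠ 0) :
    sphericalCos a b c 0 = Real.cos a := by
  simp [sphericalCos, hb]

lemma sphericalCos_half (a : ℝ) {b : ℝ} (c : ℝ) (hb : Real.sin b ≠ 0) :
    sphericalCos a b c (1 / 2) = (Real.cos a + Real.cos c) / (2 * Real.cos (b / 2)) := by
  have hsin : Real.sin b = Real.sin (b / 2) * (2 * Real.cos (b / 2)) := by
    rw [mul_left_comm, ← mul_assoc, ← Real.sin_two_mul, mul_div_cancel₀ _ two_ne_zero]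
  rw [hsin] at hb
  rw [sphericalCos, hsin, show (1 - 1 / 2) * b = b / 2 by ring, show 1 / 2 * b = b / 2 by ring,
    ← mul_add, mul_div_mul_left _ _ (left_ne_zero_of_mul hb)]

lemma hasDerivAt_sphericalCos_zero (a : ℝ) {b : ℝ} (c : ℝ) (hb : Real.sin b ≠ 0) :
    HasDerivAt (sphericalCos a b c) ((Real.cos c - Real.cos a * Real.cos b) / Real.sinc b) 0 := by
  have hb0 : b ≠ 0 := by
    rintro rfl
    exact hb Real.sin_zero
  have hleft : HasDerivAt (fun s : ℝ => (1 - s) * b) (-b) 0 := by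
    simpa using ((hasDerivAt_id (0 : ℝ)).const_sub 1).mul_const b
  have hright : HasDerivAt (fun s : ℝ => s * b) b 0 := by
    simpa using (hasDerivAt_id (0 : ℝ)).mul_const b
  refine (((hleft.sin.mul_const (Real.cos a)).fun_add
    (hright.sin.mul_const (Real.cos c))).div_const (Real.sin b)).congr_deriv ?_
  rw [Real.sinc_of_ne_zero hb0]
  simp only [sub_zero, one_mul, zero_mul, Real.cos_zero]
  field_simp
  ring

lemma mul_cos_mul_cos_sub_cos_le {a b c : ℝ} (ha : 0 ≤ a) (ha1 : a < 1) (hb : 0 ≤ b) (hb1 : b < 1)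
    (hc : 0 ≤ c) (hc1 : c < 1) :
    2 / Real.sinc a * ((Real.cos a * Real.cos b - Real.cos c) / Real.sinc b) ≤ c ^ 2 - b ^ 2 := by
  have hπ := Real.pi_gt_three
  have hsa := sinc_pos ha (by linarith)
  have hsb := sinc_pos hb (by linarith)
  have hcb : 0 ≤ Real.cos b := Real.cos_nonneg_of_mem_Icc ⟨by linarith, by linarith⟩
  have hcc : 0 ≤ Real.cos c := Real.cos_nonneg_of_mem_Icc ⟨by linarith, by linarith⟩
  have hnum : Real.cos a * Real.cos b - Real.cos c ≤ Real.sinc a * (Real.cos b - Real.cos c) := by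
    have hab := mul_le_mul_of_nonneg_right (cos_le_sinc ha (by linarith)) hcb
    have hac := mul_le_mul_of_nonneg_right (Real.sinc_le_one a) hcc
    linarith
  rw [div_mul_div_comm, div_le_iff₀ (mul_pos hsa hsb)]
  calc 2 * (Real.cos a * Real.cos b - Real.cos c)
      ≤ Real.sinc a * (2 * (Real.cos b - Real.cos c)) := by linarith
    _ ≤ Real.sinc a * (Real.sinc b * (c ^ 2 - b ^ 2)) := by
        exact mul_le_mul_of_nonneg_left
          (two_mul_cos_sub_cos_le ⟨hb, by linarith⟩ ⟨hc, by linarith⟩) hsa.le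
    _ = (c ^ 2 - b ^ 2) * (Real.sinc a * Real.sinc b) := by ring

variable {X : Type*} [MetricSpace X] {φ : X → EReal} {lam : ℝ} {x y z : X} {γ : ℝ → X}

lemma IsCAT1.sphericalCos_le_cos_dist (h : IsCAT1 X)
    (hper : dist x y + dist y z + dist z x < 2 * Real.pi) (hyz : y ≠ z) (hγ : IsMinGeodesic γ y z)
    {t : ℝ} (ht : t ∈ Set.Icc (0 : ℝ) 1) :
    sphericalCos (dist x y) (dist y z) (dist x z) t ≤ Real.cos (dist x (γ t)) := by
  obtain ⟨a, b, c, σ, ⟨ha, -, -, hab, hbc, hca⟩, hσ, hle⟩ := h.2 x y z hper γ hγ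
  have htri := dist_triangle_left y z x
  have hsin : 0 < Real.sin (dist y z) :=
    Real.sin_pos_of_pos_of_lt_pi (dist_pos.2 hyz) (by linarith [dist_comm x z])
  have hac : sphereDist a c = dist x z := by
    rwa [sphereDist, InnerProductGeometry.angle_comm, dist_comm x z]
  have hsphere := hσ.sin_mul_cos_sphereDist (mem_sphere_zero_iff_norm.1 ha) ht
  rw [hab, hbc, hac] at hsphere
  rw [sphericalCos, div_le_iff₀' hsin, ← hsphere]
  exact mul_le_mul_of_nonneg_left (Real.cos_le_cos_of_nonneg_of_le_pi dist_nonneg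
    (InnerProductGeometry.angle_le_pi _ _) (hle t ht)) hsin.le

lemma IsMinGeodesic.tendsto_nhdsGT_zero (hγ : IsMinGeodesic γ x y) :
    Tendsto γ (𝓝[>] 0) (𝓝 x) := by
  have hlim : Tendsto (fun s : ℝ => s * dist x y) (𝓝[>] 0) (𝓝 0) :=
    tendsto_nhdsWithin_of_tendsto_nhds (Continuous.tendsto' (by fun_prop) _ _ (zero_mul _))
  refine tendsto_iff_dist_tendsto_zero.2 (hlim.congr' ?_)
  filter_upwards [Ioo_mem_nhdsGT (zero_lt_one' ℝ)] with s hs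
  rw [dist_comm (γ s), hγ.dist_left (Set.Ioo_subset_Icc_self hs)]

lemma IsCAT1.localEVI (h : IsCAT1 X) (hbot : ∀ x, φ x ≠ ⊥)
    (hconv : IsLambdaConvex Set.univ lam φ) : LocalEVI (dom φ) (finitePart φ) lam 1 0 := by
  refine ⟨one_pos, le_rfl, fun τ hτ x _ z hz y hy hxz hxy hzy => ?_⟩
  have hπ := Real.pi_gt_three
  rcases eq_or_ne z y with rfl | hne
  · simp
  obtain ⟨γ, -, hγ⟩ := hconv.exists_isConvexGeodesic hbot hz.1 hy
  have hsin : Real.sin (dist z y) ≠ 0 :=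
    (Real.sin_pos_of_pos_of_lt_pi (dist_pos.2 hne) (by linarith)).ne'
  set g : ℝ → ℝ := sphericalCos (dist x z) (dist z y) (dist x y)
  have hg0 : g 0 = Real.cos (dist x z) := sphericalCos_zero _ _ hsin
  have hdist : Tendsto (fun s => dist x (γ s)) (𝓝[>] 0) (𝓝 (dist x z)) :=
    tendsto_const_nhds.dist hγ.isMinGeodesic.tendsto_nhdsGT_zero
  have hslope : Tendsto (fun s : ℝ => s⁻¹ * (g s - g 0)) (𝓝[>] 0)
      (𝓝 ((Real.cos (dist x y) - Real.cos (dist x z) * Real.cos (dist z y)) /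
        Real.sinc (dist z y))) := by
    simpa using (hasDerivAt_sphericalCos_zero (dist x z) (dist x y) hsin).tendsto_slope_zero_right
  have hlim := ((tendsto_const_nhds (x := (2 : ℝ))).div
    ((Real.continuous_sinc.tendsto _).comp hdist)
    (sinc_pos dist_nonneg (by linarith)).ne').mul hslope.neg
  have hfirst := hz.mul_sq_dist_le_of_tendsto hτ hγ (fun s hs => ?_) hlim
  · have hvar := mul_cos_mul_cos_sub_cos_le dist_nonneg hxz dist_nonneg hzy dist_nonneg hxy
    rw [← neg_div, neg_sub] at hfirst
    linarith
  · have hs' : s ∈ Set.Icc (0 : ℝ) 1 := Set.Ioo_subset_Icc_self hs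
    have hds : dist x (γ s) < Real.pi := by
      have hle := mul_le_of_le_one_left (dist_nonneg (x := z) (y := y)) hs.2.le
      linarith [dist_triangle x z (γ s), hγ.isMinGeodesic.dist_left hs']
    have hcos := two_mul_cos_sub_cos_le ⟨dist_nonneg, hds.le⟩
      (⟨dist_nonneg, by linarith⟩ : dist x z ∈ Set.Icc 0 Real.pi)
    have hcat := h.sphericalCos_le_cos_dist (by rw [dist_comm y x]; linarith) hne
      hγ.isMinGeodesic hs'
    have hsinc := sinc_pos dist_nonneg hds
    have hs0 := hs.1.ne'
    simp only [Pi.div_apply, Function.comp_apply]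
    rw [show s * (2 / Real.sinc (dist x (γ s)) * -(s⁻¹ * (g s - g 0))) =
      2 * (g 0 - g s) / Real.sinc (dist x (γ s)) by field_simp; ring, le_div_iff₀ hsinc, hg0]
    linarith

end CAT1

section Minimization

variable {X : Type*}

lemma exists_minimizer_of_dist_lt [PseudoMetricSpace X] [CompleteSpace X] {S : Set X} {F : X → ℝ}
    {m : ℝ} (hm : IsGLB (F '' S) m) (hclosed : ∀ c, IsClosed {w | w ∈ S ∧ F w ≤ c})
    (hsmall : ∀ η > 0, ∃ c > m, ∀ z ∈ S, ∀ w ∈ S, F z < c → F w < c → dist z w < η) :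
    ∃ z ∈ S, ∀ w ∈ S, F z ≤ F w := by
  obtain ⟨v, -, -, hv, hvS⟩ := hm.exists_seq_antitone_tendsto hm.nonempty
  choose u huS hu using hvS
  have hlim : Tendsto (F ∘ u) atTop (𝓝 m) := hv.congr fun n => (hu n).symm
  have hcauchy : CauchySeq u := by
    refine Metric.cauchySeq_iff.2 fun η hη => ?_
    obtain ⟨c, hc, hdist⟩ := hsmall η hη
    obtain ⟨N, hN⟩ := eventually_atTop.1 (hlim.eventually_lt_const hc)
    exact ⟨N, fun i hi j hj => hdist _ (huS i) _ (huS j) (hN i hi) (hN j hj)⟩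
  obtain ⟨z, hz⟩ := cauchySeq_tendsto_of_complete hcauchy
  have hsub {c : ℝ} (hc : m < c) : z ∈ S ∧ F z ≤ c :=
    (hclosed c).mem_of_tendsto hz
      ((hlim.eventually_le_const hc).mono fun n hn => ⟨huS n, hn⟩)
  exact ⟨z, (hsub (lt_add_one m)).1, fun w hw =>
    (le_of_forall_gt_imp_ge_of_dense fun c hc => (hsub hc).2).trans (hm.1 ⟨w, hw, rfl⟩)⟩

lemma isClosed_finitePart_add_le [TopologicalSpace X] {φ : X → EReal} (hbot : ∀ x, φ x ≠ ⊥)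
    (hlsc : LowerSemicontinuous φ) {g : X → ℝ} (hg : Continuous g) (c : ℝ) :
    IsClosed {w | w ∈ dom φ ∧ finitePart φ w + g w ≤ c} := by
  have heq : {w | w ∈ dom φ ∧ finitePart φ w + g w ≤ c} =
      (fun w => (w, ((c - g w : ℝ) : EReal))) ⁻¹' {p | φ p.1 ≤ p.2} := by
    ext w
    refine ⟨fun hw => ?_, fun hw => ⟨mem_dom_of_le_coe hw, le_sub_iff_add_le.1
      (finitePart_le hbot hw)⟩⟩
    simpa only [Set.mem_preimage, Set.mem_ofPred_eq, ← coe_finitePart hbot hw.1,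
      EReal.coe_le_coe_iff] using le_sub_iff_add_le.2 hw.2
  rw [heq]
  exact hlsc.isClosed_epigraph.preimage
    (continuous_id.prodMk (continuous_coe_real_ereal.comp (continuous_const.sub hg)))

end Minimization

section CAT1Prox

lemma cos_half_le {b : ℝ} (hb : |b / 2| ≤ Real.pi) : Real.cos (b / 2) ≤ 1 - b ^ 2 / 20 := by
  have hpi : 1 / 5 ≤ 2 / Real.pi ^ 2 := by
    rw [div_le_div_iff₀ (by norm_num) (by positivity)]
    nlinarith [Real.pi_lt_d2, Real.pi_pos]
  have hsq := mul_le_mul_of_nonneg_right hpi (sq_nonneg (b / 2))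
  linarith [Real.cos_le_one_sub_mul_cos_sq hb]

variable {X : Type*} [MetricSpace X] {φ : X → EReal} {S : Set X} {f : X → ℝ} {lam : ℝ} {x y z : X}
  {γ : ℝ → X}

lemma IsCAT1.cos_add_cos_le (h : IsCAT1 X)
    (hper : dist x y + dist y z + dist z x < 2 * Real.pi) (hγ : IsMinGeodesic γ y z) :
    Real.cos (dist x y) + Real.cos (dist x z) ≤
      2 * Real.cos (dist y z / 2) * Real.cos (dist x (γ (1 / 2))) := by
  have hhalf : (1 / 2 : ℝ) ∈ Set.Icc (0 : ℝ) 1 := ⟨by norm_num, by norm_num⟩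
  rcases eq_or_ne y z with rfl | hyz
  · have hdist := hγ.dist_left hhalf
    rw [dist_self, mul_zero, dist_eq_zero] at hdist
    rw [← hdist, dist_self, zero_div, Real.cos_zero]
    linarith
  have htri := dist_triangle_left y z x
  have hpos := dist_pos.2 hyz
  have hlt : dist y z < Real.pi := by linarith [dist_comm x z]
  have hcos : 0 < Real.cos (dist y z / 2) :=
    Real.cos_pos_of_mem_Ioo ⟨by linarith [Real.pi_pos], by linarith⟩
  have hle := h.sphericalCos_le_cos_dist hper hyz hγ hhalf
  rwa [sphericalCos_half _ _ (Real.sin_pos_of_pos_of_lt_pi hpos hlt).ne',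
    div_le_iff₀' (by positivity)] at hle

lemma IsCAT1.sq_dist_midpoint_le (h : IsCAT1 X) (hxy : dist x y ≤ 1 / 2) (hxz : dist x z ≤ 1 / 2)
    (hγ : IsMinGeodesic γ y z) :
    dist x (γ (1 / 2)) ^ 2 ≤ (dist x y ^ 2 + dist x z ^ 2) / 2 - dist y z ^ 2 / 20 := by
  have hπ := Real.pi_gt_three
  have hyz : dist y z ≤ 1 := by linarith [dist_triangle_left y z x]
  have hcat := h.cos_add_cos_le (x := x) (by rw [dist_comm z x]; linarith) hγ
  have hmid : dist x (γ (1 / 2)) ≤ 1 := by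
    linarith [dist_triangle x y (γ (1 / 2)), hγ.dist_left (t := 1 / 2) ⟨by norm_num, by norm_num⟩]
  set d := dist x (γ (1 / 2))
  have hd : 0 ≤ d := dist_nonneg
  have hcosd : 1 / 2 ≤ Real.cos d := by
    linarith [Real.one_sub_sq_div_two_le_cos (x := d), pow_le_one₀ (n := 2) hd hmid]
  have hcosL : Real.cos (dist y z / 2) ≤ 1 - dist y z ^ 2 / 20 :=
    cos_half_le (by rw [abs_of_nonneg (by positivity)]; linarith)
  have hy := two_mul_cos_sub_cos_le ⟨hd, by linarith⟩
    (⟨dist_nonneg, by linarith⟩ : dist x y ∈ Set.Icc 0 Real.pi)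
  have hz := two_mul_cos_sub_cos_le ⟨hd, by linarith⟩
    (⟨dist_nonneg, by linarith⟩ : dist x z ∈ Set.Icc 0 Real.pi)
  have hsinc : 0 < Real.sinc d := sinc_pos hd (by linarith)
  have hgap : dist y z ^ 2 / 20 ≤
      Real.sinc d * ((dist x y ^ 2 + dist x z ^ 2) / 2 - d ^ 2) := by
    have hmul : dist y z ^ 2 / 20 * (1 / 2) ≤ (1 - Real.cos (dist y z / 2)) * Real.cos d :=
      mul_le_mul (by linarith) hcosd (by norm_num) (by linarith [Real.cos_le_one (dist y z / 2)])
    linarith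
  have hnonneg : 0 ≤ (dist x y ^ 2 + dist x z ^ 2) / 2 - d ^ 2 :=
    nonneg_of_mul_nonneg_right ((by positivity : 0 ≤ dist y z ^ 2 / 20).trans hgap) hsinc
  linarith [mul_le_of_le_one_left hnonneg (Real.sinc_le_one d)]

lemma IsCAT1.sq_dist_le_of_isConvexGeodesic (h : IsCAT1 X) (hγ : IsConvexGeodesic S f lam γ y z)
    (hxy : dist x y ≤ 1 / 2) (hxz : dist x z ≤ 1 / 2) {θ : ℝ} (hθ : 20 * (1 + |lam|) ≤ θ) :
    dist y z ^ 2 ≤ ((f y + θ * dist x y ^ 2) + (f z + θ * dist x z ^ 2)) / 2 -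
      (f (γ (1 / 2)) + θ * dist x (γ (1 / 2)) ^ 2) := by
  have hθ0 : 0 ≤ θ := by linarith [abs_nonneg lam]
  have hf := hγ.le (1 / 2) ⟨by norm_num, by norm_num⟩
  have hd := mul_le_mul_of_nonneg_left (h.sq_dist_midpoint_le hxy hxz hγ.isMinGeodesic) hθ0
  have hcoef : 1 ≤ lam / 8 + θ / 20 := by linarith [neg_abs_le lam, abs_nonneg lam]
  linarith [mul_le_mul_of_nonneg_right hcoef (sq_nonneg (dist y z))]

lemma QuadraticLowerBound.le_add_mul_sq_dist {C θ : ℝ} (hlow : QuadraticLowerBound S f C x)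
    (hy : y ∈ S) (hθ : |C| + 4 * (1 + |C|) ≤ θ) :
    f x - |C| + 4 * (1 + |C|) * dist x y ^ 2 ≤ f y + θ * dist x y ^ 2 := by
  have hC := mul_le_mul_of_nonneg_right (le_abs_self C)
    (by positivity : 0 ≤ 1 + dist x y ^ 2)
  linarith [hlow y hy, mul_le_mul_of_nonneg_right hθ (sq_nonneg (dist x y))]

lemma IsCAT1.exists_minimizer_add_mul_sq_dist [CompleteSpace X] (h : IsCAT1 X)
    (hbot : ∀ x, φ x ≠ ⊥) (hlsc : LowerSemicontinuous φ) (hconv : IsLambdaConvex Set.univ lam φ)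
    (hx : x ∈ dom φ) {C θ : ℝ} (hlow : QuadraticLowerBound (dom φ) (finitePart φ) C x)
    (hC : |C| + 4 * (1 + |C|) ≤ θ) (hlam : 20 * (1 + |lam|) ≤ θ) :
    ∃ z ∈ dom φ, ∀ w ∈ dom φ,
      finitePart φ z + θ * dist x z ^ 2 ≤ finitePart φ w + θ * dist x w ^ 2 := by
  set F : X → ℝ := fun w => finitePart φ w + θ * dist x w ^ 2
  have hbdd : BddBelow (F '' dom φ) := by
    refine ⟨finitePart φ x - |C|, ?_⟩
    rintro _ ⟨w, hw, rfl⟩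
    exact (le_add_of_nonneg_right (by positivity)).trans (hlow.le_add_mul_sq_dist hw hC)
  have hm := isGLB_csInf (Set.image_nonempty.2 ⟨x, hx⟩) hbdd
  set m := sInf (F '' dom φ)
  have hmx : m ≤ finitePart φ x := by simpa [F] using hm.1 ⟨x, hx, rfl⟩
  have hnear {w : X} (hw : w ∈ dom φ) (hFw : F w < m + 1) : dist x w ≤ 1 / 2 := by
    have hmul : (1 + |C|) * (4 * dist x w ^ 2) ≤ (1 + |C|) * 1 := by
      linarith [hlow.le_add_mul_sq_dist hw hC]
    have hsq := le_of_mul_le_mul_left hmul (by positivity)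
    exact abs_le_of_sq_le_sq' (by linarith) (by norm_num) |>.2
  refine exists_minimizer_of_dist_lt hm (isClosed_finitePart_add_le hbot hlsc (by fun_prop))
    fun η hη => ⟨m + min 1 (η ^ 2), lt_add_of_pos_right _ (by positivity),
      fun y hy z hz hFy hFz => ?_⟩
  obtain ⟨γ, -, hγ⟩ := hconv.exists_isConvexGeodesic hbot hy hz
  have hpair := h.sq_dist_le_of_isConvexGeodesic hγ
    (hnear hy (hFy.trans_le (by simp))) (hnear hz (hFz.trans_le (by simp))) hlam
  have hmid : m ≤ F (γ (1 / 2)) := hm.1 ⟨_, hγ.mem _ ⟨by norm_num, by norm_num⟩, rfl⟩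
  refine lt_of_pow_lt_pow_left₀ 2 hη.le ?_
  linarith [min_le_right 1 (η ^ 2)]

lemma IsCAT1.hasProx [CompleteSpace X] (h : IsCAT1 X) (hbot : ∀ x, φ x ≠ ⊥)
    (hlsc : LowerSemicontinuous φ) (hconv : IsLambdaConvex Set.univ lam φ) :
    HasProx (dom φ) (finitePart φ) := by
  intro C
  set H : ℝ := |C| + 4 * (1 + |C|) + 20 * (1 + |lam|)
  have hC0 := abs_nonneg C
  have hlam0 := abs_nonneg lam
  refine ⟨1 / (2 * H), by positivity, fun x hx hlow τ hτ hlt => ?_⟩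
  have hθ : H ≤ 1 / (2 * τ) := by
    rw [lt_div_iff₀ (by positivity)] at hlt
    rw [le_div_iff₀ (by positivity)]
    linarith
  obtain ⟨z, hz, hmin⟩ := h.exists_minimizer_add_mul_sq_dist hbot hlsc hconv hx hlow
    (θ := 1 / (2 * τ)) (by linarith) (by linarith)
  exact ⟨z, hz, by simpa only [one_div_mul_eq_div] using hmin⟩

end CAT1Prox

end MetricFlow

theorem theorem4p4 {X : Type*} [MetricSpace X] [CompleteSpace X]
    (φ : X → EReal) (lam : ℝ)
    (hbot : ∀ x, φ x ≠ ⊥) (hlsc : LowerSemicontinuous φ)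
    (hcase :
      (MetricFlow.IsCAT1 X ∧ MetricFlow.IsLambdaConvex Set.univ lam φ) ∨
      (∃ (Γ : Set (ℝ → X)) (K : ℝ),
        MetricFlow.IsLambdaConvex Γ lam φ ∧ MetricFlow.SqDistConvex Γ K ∧
        MetricFlow.SqDistCommutes Γ ∧ MetricFlow.IsCoercive φ)) :
    (∀ x₀ ∈ MetricFlow.dom φ, ∃! ξ : ℝ≥0 → X, MetricFlow.IsGradientCurve φ x₀ ξ) ∧
    ∀ x₀ ∈ MetricFlow.dom φ, ∀ y₀ ∈ MetricFlow.dom φ, ∀ ξ ζ : ℝ≥0 → X,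
      MetricFlow.IsGradientCurve φ x₀ ξ → MetricFlow.IsGradientCurve φ y₀ ζ →
      ∀ t : ℝ≥0, 0 < t →
        dist (ξ t) (ζ t) ≤ Real.exp (-lam * (t : ℝ)) * dist x₀ y₀ := by
  open MetricFlow in
  obtain ⟨Γ, K, hconv, hevi, hprox⟩ : ∃ Γ K, IsLambdaConvex Γ lam φ ∧
      LocalEVI (dom φ) (finitePart φ) lam 1 K ∧ HasProx (dom φ) (finitePart φ) := by
    rcases hcase with ⟨hcat, hconv⟩ | ⟨Γ, K, hconv, hK, hcomm, hcoer⟩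
    · exact ⟨Set.univ, 0, hconv, hcat.localEVI hbot hconv, hcat.hasProx hbot hlsc hconv⟩
    · exact ⟨Γ, |K| / 2, hconv, hcomm.localEVI hbot hconv hK one_pos, hcoer.hasProx hbot⟩
  have hgrowth (x : X) (hx : x ∈ MetricFlow.dom φ) :=
    hconv.exists_quadraticLowerBound hbot hlsc hx
  refine ⟨fun x₀ hx₀ => ?_, fun x₀ hx₀ y₀ hy₀ ξ ζ hξ hζ t _ => ?_⟩
  · obtain ⟨ξ, hξ⟩ := MetricFlow.exists_isGradientCurve hbot hevi hgrowth hprox hx₀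
    exact ⟨ξ, hξ, fun ζ hζ => hζ.eq hbot hevi hgrowth hx₀ hξ⟩
  · obtain ⟨γ, -, hγ⟩ := hconv.exists_isConvexGeodesic hbot hx₀ hy₀
    exact hevi.dist_gradientCurve_le hbot hgrowth hprox hγ.isMinGeodesic hγ.mem hξ hζ t
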